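/- Let $(M,g)$ be a Riemannian supermanifold: $M$ is a (smooth, real, finite-dimensional) supermanifold of dimension $p|q$, and $g$ is a metric on $M$, i.e. an even, graded symmetric, nondegenerate smooth section of $T^*M\otimes T^*M$. Write $\varepsilon$ for parity. A connection in $TM$ is a biadditive map $\nabla:\Gamma(TM)\times\Gamma(TM)\to\Gamma(TM)$ which is even, i.e. $\varepsilon(\nabla_XY)=\varepsilon(X)+\varepsilon(Y)$ for homogeneous $X,Y$, and satisfies $\nabla_{fX}Y=f\,\nabla_XY$ for all $f\in C^\infty(M)$ and $\nabla_X(fY)=(Xf)\,Y+(-1)^{\varepsilon(X)\varepsilon(f)}f\,\nabla_XY$ for homogeneous $X,f$. Then there is a unique connection $\nabla$ in $TM$ which is torsion-free, $$\nabla_XY-(-1)^{\varepsilon(X)\varepsilon(Y)}\nabla_YX=[X,Y]\qquad\text{for all homogeneous } X,Y\in\Gamma(TM),$$ and compatible with $g$, $$X\bigl(g(Y,Z)\bigr)=g(\nabla_XY,Z)+(-1)^{\varepsilon(X)\varepsilon(Y)}g(Y,\nabla_XZ)\qquad\text{for all homogeneous } X,Y,Z\in\Gamma(TM).$$ Moreover,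 let $x^1,\dots,x^{p+q}$ be any system of local coordinates, on an open subset $U$ of $M$, with parities $\varepsilon_i=\varepsilon(x^i)$; let $g_{ij}=g(\partial_{x^i},\partial_{x^j})$, and let $(g^{ij})$ be the inverse matrix, $\sum_jg_{ij}g^{jk}=\delta_i^k=\sum_jg^{kj}g_{ji}$. Then the restriction of $\nabla$ to $U$ (the unique connection on $U$ with $\nabla_{X|_U}(Y|_U)=(\nabla_XY)|_U$ for all $X,Y\in\Gamma(TM)$) has the Christoffel symbols $\Gamma^i_{jk}=(\nabla_{\partial_{x^j}}\partial_{x^k})(x^i)$ given by $$\Gamma_{jk}^i=\tfrac12\sum_\ell\Bigl(\partial_{x^j}g_{k\ell}+(-1)^{\varepsilon_j\varepsilon_k}\,\partial_{x^k}g_{j\ell}-(-1)^{\varepsilon_\ell(\varepsilon_j+\varepsilon_k)}\,\partial_{x^\ell}g_{jk}\Bigr)\,g^{\ell i}.$$ -/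

import Mathlib

open CategoryTheory TopologicalSpace Opposite
open scoped Manifold ContDiff

universe u

open Finset in
/-- The number of inversions between two sets of indices: pairs `(i, j)` with `i ∈ I`, `j ∈ J` and
`j < i`.  For disjoint `I`, `J` one has `ξ^I ξ^J = (-1)^(inversions I J) ξ^(I ∪ J)`. -/
def inversions {q : ℕ} (I J : Finset (Fin q)) : ℕ := ∑ i ∈ I, #{j ∈ J | j < i}

/-- The Grassmann algebra `R ⊗ Λ(ξ_1, …, ξ_q)`: an element is written uniquely as `∑_I a_I ξ^I`,
where `ξ^I` is the product of the `ξ_i`, `i ∈ I`, in increasing order; it is represented by its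
coefficients `a_I`. -/
def Grassmann (R : Type*) (q : ℕ) : Type _ := Finset (Fin q) → R

namespace Grassmann

variable {R : Type*} [CommRing R] {q : ℕ}

instance : AddCommGroup (Grassmann R q) := inferInstanceAs (AddCommGroup (Finset (Fin q) → R))

instance {S : Type*} [CommRing S] [Algebra S R] : Module S (Grassmann R q) :=
  inferInstanceAs (Module S (Finset (Fin q) → R))

@[ext] theorem ext {R : Type*} {q : ℕ} {a b : Grassmann R q} (h : ∀ I, a I = b I) : a = b := funext h

@[simp] theorem add_apply (a b : Grassmann R q) (I : Finset (Fin q)) : (a + b) I = a I + b I := rfl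

@[simp] theorem zero_apply (I : Finset (Fin q)) : (0 : Grassmann R q) I = 0 := rfl

@[simp] theorem smul_apply {S : Type*} [CommRing S] [Algebra S R] (r : S) (a : Grassmann R q)
    (I : Finset (Fin q)) : (r • a) I = r • a I := rfl

/-- `(∑ a_I ξ^I) (∑ b_J ξ^J) = ∑_K (∑_{I ⊔ J = K} ± a_I b_J) ξ^K`. -/
instance : Mul (Grassmann R q) :=
  ⟨fun a b K => ∑ I ∈ K.powerset, (-1) ^ inversions I (K \ I) * (a I * b (K \ I))⟩

theorem mul_apply (a b : Grassmann R q) (K : Finset (Fin q)) :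
    (a * b) K = ∑ I ∈ K.powerset, (-1) ^ inversions I (K \ I) * (a I * b (K \ I)) := rfl

instance : One (Grassmann R q) := ⟨fun I => if I = ∅ then 1 else 0⟩

theorem one_apply (I : Finset (Fin q)) :
    (1 : Grassmann R q) I = if I = ∅ then 1 else 0 := rfl

theorem inversions_union_left {I J : Finset (Fin q)} (h : Disjoint I J) (K : Finset (Fin q)) :
    inversions (I ∪ J) K = inversions I K + inversions J K := Finset.sum_union h

theorem inversions_union_right {J K : Finset (Fin q)} (h : Disjoint J K) (I : Finset (Fin q)) :
    inversions I (J ∪ K) = inversions I J + inversions I K := by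
  unfold inversions
  rw [← Finset.sum_add_distrib]
  refine Finset.sum_congr rfl fun i _ => ?_
  rw [Finset.filter_union, Finset.card_union_of_disjoint]
  exact Finset.disjoint_filter_filter h

theorem inversions_empty_left (K : Finset (Fin q)) : inversions ∅ K = 0 := rfl

theorem inversions_empty_right (K : Finset (Fin q)) : inversions K ∅ = 0 := by simp [inversions]

protected theorem mul_assoc (a b c : Grassmann R q) : a * b * c = a * (b * c) := by
  ext K
  simp only [mul_apply, Finset.sum_mul, Finset.mul_sum]
  rw [Finset.sum_sigma', Finset.sum_sigma']
  refine Finset.sum_bij' (fun x _ => ⟨x.2, x.1 \ x.2⟩) (fun x _ => ⟨x.1 ∪ x.2, x.1⟩) ?_ ?_ ?_ ?_ ?_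
  · rintro ⟨L, I⟩ h
    simp only [Finset.mem_sigma, Finset.mem_powerset] at h ⊢
    exact ⟨h.2.trans h.1, Finset.sdiff_subset_sdiff h.1 le_rfl⟩
  · rintro ⟨I, J⟩ h
    simp only [Finset.mem_sigma, Finset.mem_powerset] at h ⊢
    exact ⟨Finset.union_subset h.1 (h.2.trans Finset.sdiff_subset), Finset.subset_union_left⟩
  · rintro ⟨L, I⟩ h
    simp only [Finset.mem_sigma, Finset.mem_powerset] at h ⊢
    simp [Finset.union_sdiff_of_subset h.2]
  · rintro ⟨I, J⟩ h
    simp only [Finset.mem_sigma, Finset.mem_powerset] at h ⊢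
    have : Disjoint J I := Finset.disjoint_of_subset_left h.2 Finset.sdiff_disjoint
    simp [Finset.union_sdiff_left, Finset.sdiff_eq_self_of_disjoint this]
  · rintro ⟨L, I⟩ h
    simp only [Finset.mem_sigma, Finset.mem_powerset] at h
    obtain ⟨J, hJ, rfl⟩ : ∃ J, Disjoint I J ∧ L = I ∪ J :=
      ⟨L \ I, Finset.disjoint_sdiff, (Finset.union_sdiff_of_subset h.2).symm⟩
    obtain ⟨M, hM, rfl⟩ : ∃ M, Disjoint (I ∪ J) M ∧ K = (I ∪ J) ∪ M :=
      ⟨K \ (I ∪ J), Finset.disjoint_sdiff, (Finset.union_sdiff_of_subset h.1).symm⟩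
    have hM' := Finset.disjoint_union_left.1 hM
    have e1 : (I ∪ J) \ I = J := by
      rw [Finset.union_sdiff_left, Finset.sdiff_eq_self_of_disjoint hJ.symm]
    have e2 : ((I ∪ J) ∪ M) \ (I ∪ J) = M := by
      rw [Finset.union_sdiff_left, Finset.sdiff_eq_self_of_disjoint hM.symm]
    have e3 : ((I ∪ J) ∪ M) \ I = J ∪ M := by
      rw [Finset.union_assoc, Finset.union_sdiff_left, Finset.sdiff_eq_self_of_disjoint]
      exact Finset.disjoint_union_left.2 ⟨hJ.symm, hM'.1.symm⟩
    have e4 : (J ∪ M) \ J = M := by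
      rw [Finset.union_sdiff_left, Finset.sdiff_eq_self_of_disjoint hM'.2.symm]
    simp only [e1, e2, e3, e4]
    rw [inversions_union_left hJ, inversions_union_right hM'.2]
    ring

instance : Ring (Grassmann R q) where
  __ := (inferInstance : AddCommGroup (Grassmann R q))
  mul_assoc := Grassmann.mul_assoc
  one_mul a := by
    ext K
    rw [mul_apply, Finset.sum_eq_single ∅]
    · simp [one_apply, inversions_empty_left]
    · intro I _ hI
      simp [one_apply, hI]
    · simp
  mul_one a := by
    ext K
    rw [mul_apply, Finset.sum_eq_single K]
    · simp [one_apply, inversions_empty_right]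
    · intro I hI hIK
      have : ¬ K ⊆ I := fun h => hIK ((Finset.mem_powerset.1 hI).antisymm h)
      simp [one_apply, Finset.sdiff_eq_empty_iff_subset, this]
    · simp
  left_distrib a b c := by ext K; simp [mul_apply, mul_add, Finset.sum_add_distrib]
  right_distrib a b c := by ext K; simp [mul_apply, mul_add, add_mul, Finset.sum_add_distrib]
  zero_mul a := by ext K; simp [mul_apply]
  mul_zero a := by ext K; simp [mul_apply]

instance {S : Type*} [CommRing S] [Algebra S R] : Algebra S (Grassmann R q) :=
  Algebra.ofModule
    (fun r a b => by ext K; simp [mul_apply, Finset.smul_sum])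
    (fun r a b => by ext K; simp [mul_apply, Finset.smul_sum])

/-- Conjugation in the odd part: the automorphism that is `1` on even and `-1` on odd elements. -/
def conj (a : Grassmann R q) : Grassmann R q := fun I => (-1) ^ I.card * a I

/-- The odd generator `ξ_j`. -/
def gen (j : Fin q) : Grassmann R q := fun I => if I = {j} then 1 else 0

/-- An element of `R` as a constant of the Grassmann algebra. -/
def const (r : R) : Grassmann R q := fun I => if I = ∅ then r else 0

/-- The left derivative `∂/∂ξ_j`, which removes `ξ_j` after moving it to the far left. -/
def oddDeriv (j : Fin q) (a : Grassmann R q) : Grassmann R q :=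
  fun K => if j ∈ K then 0 else (-1) ^ inversions {j} K * a (insert j K)

theorem conj_mul (a b : Grassmann R q) : conj (a * b) = conj a * conj b := by
  ext K
  simp only [conj, mul_apply, Finset.mul_sum]
  refine Finset.sum_congr rfl fun I hI => ?_
  rw [← Finset.card_sdiff_add_card_eq_card (Finset.mem_powerset.1 hI), pow_add]
  ring

theorem inversions_singleton_add {j : Fin q} {I : Finset (Fin q)} (h : j ∉ I) :
    inversions {j} I + inversions I {j} = I.card := by
  have : inversions I {j} = ∑ i ∈ I, if j < i then 1 else 0 := by
    refine Finset.sum_congr rfl fun i _ => ?_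
    by_cases hh : j < i <;> simp [Finset.filter_singleton, hh]
  rw [this, ← Finset.card_filter]
  simp only [inversions, Finset.sum_singleton]
  rw [← Finset.card_filter_add_card_filter_not (s := I) (fun i => i < j)]
  congr 2
  refine Finset.filter_congr fun i hi => ?_
  have : i ≠ j := fun e => h (e ▸ hi)
  omega

theorem inversions_insert_left {j : Fin q} {I : Finset (Fin q)} (h : j ∉ I) (K : Finset (Fin q)) :
    inversions (insert j I) K = inversions {j} K + inversions I K := by
  rw [Finset.insert_eq, inversions_union_left (Finset.disjoint_singleton_left.2 h)]

theorem inversions_insert_right {j : Fin q} {K : Finset (Fin q)} (h : j ∉ K) (I : Finset (Fin q)) :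
    inversions I (insert j K) = inversions I {j} + inversions I K := by
  rw [Finset.insert_eq, inversions_union_right (Finset.disjoint_singleton_left.2 h)]

theorem mul_apply_insert (a b : Grassmann R q) {j : Fin q} {K : Finset (Fin q)} (hj : j ∉ K) :
    (a * b) (insert j K) = ∑ I ∈ K.powerset,
      ((-1) ^ inversions I (insert j (K \ I)) * (a I * b (insert j (K \ I))) +
        (-1) ^ inversions (insert j I) (K \ I) * (a (insert j I) * b (K \ I))) := by
  rw [mul_apply, Finset.sum_powerset_insert hj, ← Finset.sum_add_distrib]
  refine Finset.sum_congr rfl fun I hI => ?_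
  have hjI : j ∉ I := fun h => hj (Finset.mem_powerset.1 hI h)
  rw [Finset.insert_sdiff_of_notMem K hjI, Finset.insert_sdiff_insert,
    Finset.sdiff_insert_of_notMem hj]

theorem oddDeriv_mul (j : Fin q) (a b : Grassmann R q) :
    oddDeriv j (a * b) = oddDeriv j a * b + conj a * oddDeriv j b := by
  ext K
  by_cases hj : j ∈ K
  · obtain ⟨L, hL, rfl⟩ : ∃ L, j ∉ L ∧ K = insert j L :=
      ⟨K.erase j, Finset.notMem_erase j K, (Finset.insert_erase hj).symm⟩
    rw [add_apply, mul_apply_insert _ _ hL, mul_apply_insert _ _ hL, ← Finset.sum_add_distrib]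
    simp only [oddDeriv, hj, if_true]
    refine (Finset.sum_eq_zero fun I hI => ?_).symm
    have hjI : j ∉ I := fun h => hL (Finset.mem_powerset.1 hI h)
    have hjJ : j ∉ L \ I := fun h => hL (Finset.sdiff_subset h)
    have e := inversions_singleton_add hjI
    simp only [hjI, hjJ, Finset.mem_insert_self, if_true, if_false, conj,
      Finset.card_insert_of_notMem hjI, ← e, inversions_insert_left hjI,
      inversions_insert_right hjJ, pow_add, pow_one]
    have h2 : ∀ n : ℕ, ((-1 : R) ^ n) * (-1) ^ n = 1 := fun n => by
      rw [← pow_add, ← two_mul]; simp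
    linear_combination (-(-1 : R) ^ inversions {j} I * (-1) ^ inversions I {j} *
      (-1) ^ inversions I (L \ I) * a (insert j I) * b (insert j (L \ I))) *
        (h2 (inversions {j} (L \ I)))
  · have h2 : ∀ n : ℕ, ((-1 : R) ^ n) * (-1) ^ n = 1 := fun n => by
      rw [← pow_add, ← two_mul]; simp
    simp only [oddDeriv, hj, if_false, add_apply]
    rw [mul_apply_insert _ _ hj, mul_apply, mul_apply, ← Finset.sum_add_distrib, Finset.mul_sum]
    refine Finset.sum_congr rfl fun I hI => ?_
    have hIK := Finset.mem_powerset.1 hI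
    have hjI : j ∉ I := fun h => hj (hIK h)
    have hjJ : j ∉ K \ I := fun h => hj (Finset.sdiff_subset h)
    have e := inversions_singleton_add hjI
    have eK : inversions {j} K = inversions {j} I + inversions {j} (K \ I) := by
      rw [← inversions_union_right Finset.disjoint_sdiff, Finset.union_sdiff_of_subset hIK]
    simp only [oddDeriv, hjI, hjJ, if_false, conj, ← e, eK, inversions_insert_left hjI,
      inversions_insert_right hjJ, pow_add]
    linear_combination ((-1 : R) ^ inversions {j} I * (-1) ^ inversions I (K \ I) *
      a (insert j I) * b (K \ I)) * (h2 (inversions {j} (K \ I)))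
theorem conj_conj (a : Grassmann R q) : conj (conj a) = a := by
  ext K
  simp only [conj]
  rw [← mul_assoc, ← pow_add, ← two_mul]
  simp

theorem oddDeriv_conj (j : Fin q) (a : Grassmann R q) :
    oddDeriv j (conj a) = -conj (oddDeriv j a) := by
  ext K
  change _ = -(_)
  by_cases hj : j ∈ K
  · simp [oddDeriv, conj, hj]
  · simp only [oddDeriv, conj, hj, if_false, Finset.card_insert_of_notMem hj]
    ring

/-- A derivation of `R`, acting on the coefficients of an element of the Grassmann algebra. -/
def evenDeriv {S : Type*} [CommRing S] [Algebra S R] (D : Derivation S R R)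
    (a : Grassmann R q) : Grassmann R q := fun I => D (a I)

theorem evenDeriv_mul {S : Type*} [CommRing S] [Algebra S R] (D : Derivation S R R)
    (a b : Grassmann R q) :
    evenDeriv D (a * b) = evenDeriv D a * b + a * evenDeriv D b := by
  ext K
  simp only [evenDeriv, mul_apply, add_apply, map_sum, ← Finset.sum_add_distrib]
  refine Finset.sum_congr rfl fun I _ => ?_
  have : D ((-1 : R) ^ inversions I (K \ I)) = 0 := by
    rcases neg_one_pow_eq_or R (inversions I (K \ I)) with h | h <;> simp [h]
  simp only [Derivation.leibniz, this, smul_eq_mul]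
  ring

theorem evenDeriv_conj {S : Type*} [CommRing S] [Algebra S R] (D : Derivation S R R)
    (a : Grassmann R q) : evenDeriv D (conj a) = conj (evenDeriv D a) := by
  ext K
  rcases neg_one_pow_eq_or R K.card with h | h <;> simp [evenDeriv, conj, h]

end Grassmann

/-- The algebra `C^∞(W)` of smooth real functions on an open subset `W` of `ℝ^p`. -/
abbrev SmoothFun {p : ℕ} (W : Opens (EuclideanSpace ℝ (Fin p))) : Type :=
  C^∞⟮𝓘(ℝ, EuclideanSpace ℝ (Fin p)), W; 𝓘(ℝ), ℝ⟯

namespace SmoothFun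

variable {p : ℕ} {W : Opens (EuclideanSpace ℝ (Fin p))}

/-- Extension by zero to the whole of `ℝ^p`; used only to differentiate at points of `W`. -/
noncomputable def extend (f : SmoothFun W) : EuclideanSpace ℝ (Fin p) → ℝ :=
  Function.extend Subtype.val f 0

@[simp] theorem extend_coe (f : SmoothFun W) (w : W) : f.extend w = f w :=
  Subtype.val_injective.extend_apply _ _ _

theorem contDiffAt_extend (f : SmoothFun W) (w : W) : ContDiffAt ℝ ∞ f.extend w := by
  rw [← contMDiffAt_iff_contDiffAt, ← contMDiffAt_subtype_iff]
  simpa using f.contMDiff w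

theorem contMDiff_of_contDiffAt (F : EuclideanSpace ℝ (Fin p) → ℝ)
    (h : ∀ w : W, ContDiffAt ℝ ∞ F w) :
    ContMDiff 𝓘(ℝ, EuclideanSpace ℝ (Fin p)) 𝓘(ℝ) ∞ (fun w : W => F w) := fun w =>
  contMDiffAt_subtype_iff.2 (contMDiffAt_iff_contDiffAt.2 (h w))

theorem extend_eventuallyEq {F : EuclideanSpace ℝ (Fin p) → ℝ} {f : SmoothFun W}
    (h : ∀ w : W, f w = F w) (w : W) : f.extend =ᶠ[nhds (w : EuclideanSpace ℝ (Fin p))] F := by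
  filter_upwards [W.isOpen.mem_nhds w.2] with x hx
  exact (f.extend_coe ⟨x, hx⟩).trans (h ⟨x, hx⟩)

theorem contDiffAt_fderiv_extend (j : Fin p) (f : SmoothFun W) (w : W) :
    ContDiffAt ℝ ∞ (fun x => fderiv ℝ f.extend x (EuclideanSpace.single j (1 : ℝ))) w :=
  ((f.contDiffAt_extend w).fderiv_right (m := ∞) (by simp)).clm_apply contDiffAt_const

theorem differentiableAt_extend (f : SmoothFun W) (w : W) : DifferentiableAt ℝ f.extend w :=
  (f.contDiffAt_extend w).differentiableAt (by simp)

/-- The partial derivative `∂f/∂x_j` of a smooth function on `W`. -/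
noncomputable def pderivFun (j : Fin p) (f : SmoothFun W) : SmoothFun W :=
  ⟨fun w => fderiv ℝ f.extend w (EuclideanSpace.single j (1 : ℝ)),
    contMDiff_of_contDiffAt _ (f.contDiffAt_fderiv_extend j)⟩

theorem pderivFun_apply (j : Fin p) (f : SmoothFun W) (w : W) :
    pderivFun j f w = fderiv ℝ f.extend w (EuclideanSpace.single j (1 : ℝ)) := rfl

theorem pderivFun_add (j : Fin p) (f g : SmoothFun W) :
    pderivFun j (f + g) = pderivFun j f + pderivFun j g := by
  ext w
  have := (extend_eventuallyEq (f := f + g) (F := f.extend + g.extend) (fun w => by simp) w).fderiv_eq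
    (𝕜 := ℝ)
  rw [ContMDiffMap.coe_add, Pi.add_apply, pderivFun_apply, pderivFun_apply, pderivFun_apply, this,
    fderiv_add (f.differentiableAt_extend w) (g.differentiableAt_extend w)]
  rfl

theorem pderivFun_smul (j : Fin p) (r : ℝ) (f : SmoothFun W) :
    pderivFun j (r • f) = r • pderivFun j f := by
  ext w
  have := (extend_eventuallyEq (f := r • f) (F := r • f.extend) (fun w => by simp) w).fderiv_eq
    (𝕜 := ℝ)
  rw [ContMDiffMap.coe_smul, Pi.smul_apply, pderivFun_apply, pderivFun_apply, this,
    fderiv_const_smul (f.differentiableAt_extend w)]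
  rfl

theorem pderivFun_mul (j : Fin p) (f g : SmoothFun W) :
    pderivFun j (f * g) = f * pderivFun j g + g * pderivFun j f := by
  ext w
  have := (extend_eventuallyEq (f := f * g) (F := f.extend * g.extend) (fun w => by simp) w).fderiv_eq
    (𝕜 := ℝ)
  rw [ContMDiffMap.coe_add, Pi.add_apply, ContMDiffMap.coe_mul, ContMDiffMap.coe_mul, Pi.mul_apply,
    Pi.mul_apply, pderivFun_apply, pderivFun_apply, pderivFun_apply, this,
    fderiv_mul (f.differentiableAt_extend w) (g.differentiableAt_extend w)]
  simp

/-- The partial derivative `∂/∂x_j` as a derivation of `C^∞(W)`. -/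
noncomputable def pderiv (j : Fin p) : Derivation ℝ (SmoothFun W) (SmoothFun W) :=
  Derivation.mk'
    ({ toFun := pderivFun j
       map_add' := pderivFun_add j
       map_smul' := pderivFun_smul j } : SmoothFun W →ₗ[ℝ] SmoothFun W)
    (pderivFun_mul j)

theorem pderiv_apply (j : Fin p) (f : SmoothFun W) (w : W) :
    pderiv j f w = fderiv ℝ f.extend w (EuclideanSpace.single j (1 : ℝ)) := rfl

/-- The coordinate function `x_j` on `W`. -/
noncomputable def coord (j : Fin p) : SmoothFun W :=
  ⟨fun w => (w : EuclideanSpace ℝ (Fin p)) j,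
    contMDiff_of_contDiffAt (fun x => x j) fun _ =>
      (EuclideanSpace.proj j : EuclideanSpace ℝ (Fin p) →L[ℝ] ℝ).contDiff.contDiffAt⟩

end SmoothFun

/-- The sign `(-1)^a` for `a ∈ ℤ/2`. -/
def sgn (a : ZMod 2) : ℝ := if a = 0 then 1 else -1

/-- The parity `ε_i` of the `i`-th coordinate, the coordinates being indexed by `Fin p ⊕ Fin q`
(first the even ones, then the odd ones). -/
def parity {p q : ℕ} : Fin p ⊕ Fin q → ZMod 2 := Sum.elim (fun _ => 0) (fun _ => 1)

/-- A topological space with a sheaf of real supercommutative superalgebras.  The `ℤ/2`-grading is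
given by the conjugation in the odd part, an involutive automorphism of the sheaf: the even and the
odd part are its eigenspaces for `1` and `-1`. -/
structure SuperRingedSpace extends AlgebraicGeometry.SheafedSpace.{u + 1, u, u} (AlgCat.{u} ℝ) where
  conjMap : presheaf ⟶ presheaf
  conjMap_comp : conjMap ≫ conjMap = 𝟙 presheaf
  supercomm : ∀ (U : Opens carrier) (f g : presheaf.obj (op U)) (a b : ZMod 2),
    (conjMap.app (op U)).hom f = sgn a • f → (conjMap.app (op U)).hom g = sgn b • g →
    f * g = sgn (a * b) • (g * f)

namespace SuperRingedSpace

variable (M : SuperRingedSpace.{u})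

/-- The algebra of sections (superfunctions) over `U`. -/
abbrev Sec (U : Opens M.carrier) : Type u := M.presheaf.obj (op U)

variable {M}

/-- Restriction of superfunctions. -/
def res {U V : Opens M.carrier} (h : V ≤ U) : M.Sec U →ₐ[ℝ] M.Sec V :=
  (M.presheaf.map (homOfLE h).op).hom

/-- Conjugation in the odd part: `f₀ + f₁ ↦ f₀ - f₁`. -/
def conj (U : Opens M.carrier) : M.Sec U →ₐ[ℝ] M.Sec U := (M.conjMap.app (op U)).hom

/-- The `a`-fold conjugation: the identity for `a = 0`, the conjugation for `a = 1`. -/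
def twist (a : ZMod 2) (U : Opens M.carrier) : M.Sec U →ₐ[ℝ] M.Sec U := conj U ^ a.val

/-- `f` is homogeneous of parity `a`. -/
def IsHomogeneous {U : Opens M.carrier} (f : M.Sec U) (a : ZMod 2) : Prop := conj U f = sgn a • f

theorem conj_conj {U : Opens M.carrier} (f : M.Sec U) : conj U (conj U f) = f :=
  congrArg (fun φ => (φ.app (op U)).hom f) M.conjMap_comp

theorem res_conj {U V : Opens M.carrier} (h : V ≤ U) (f : M.Sec U) :
    res h (conj U f) = conj V (res h f) :=
  (congrArg (fun φ => φ.hom f) (M.conjMap.naturality (homOfLE h).op)).symm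

theorem res_res {U V W : Opens M.carrier} (h : V ≤ U) (h' : W ≤ V) (f : M.Sec U) :
    res h' (res h f) = res (h'.trans h) f :=
  (congrArg (fun φ => φ.hom f) (M.presheaf.map_comp (homOfLE h).op (homOfLE h').op)).symm

theorem res_self {U : Opens M.carrier} (f : M.Sec U) : res le_rfl f = f :=
  congrArg (fun φ => φ.hom f) (M.presheaf.map_id (op U))

theorem zmod_two (a : ZMod 2) : a = 0 ∨ a = 1 := by
  revert a; decide

theorem twist_zero {U : Opens M.carrier} (f : M.Sec U) : twist 0 U f = f := rfl

theorem twist_one {U : Opens M.carrier} (f : M.Sec U) : twist 1 U f = conj U f := rfl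

/-- Moving a superfunction past a homogeneous one. -/
theorem mul_eq_mul_twist {U : Opens M.carrier} (h f : M.Sec U) {b : ZMod 2}
    (hf : IsHomogeneous f b) : h * f = f * twist b U h := by
  have h0 : IsHomogeneous (h + conj U h) 0 := by
    simp [IsHomogeneous, sgn, conj_conj, add_comm]
  have h1 : IsHomogeneous (h - conj U h) 1 := by
    simp [IsHomogeneous, sgn, conj_conj]
  have e0 := M.supercomm U _ f 0 b h0 hf
  have e1 := M.supercomm U _ f 1 b h1 hf
  have e : (2 : ℝ) • h = (h + conj U h) + (h - conj U h) := by rw [two_smul]; abel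
  refine smul_right_injective _ (two_ne_zero (α := ℝ)) ?_
  change (2 : ℝ) • (h * f) = (2 : ℝ) • (f * twist b U h)
  rw [← smul_mul_assoc, e, add_mul, e0, e1, ← mul_smul_comm, ← mul_smul_comm, ← mul_smul_comm,
    ← mul_add]
  congr 1
  rcases zmod_two b with rfl | rfl
  · simp [sgn, twist_zero, two_smul]
  · simp only [mul_one, sgn, if_true, twist_one, two_smul, one_ne_zero, if_false, one_smul, neg_smul]
    abel

end SuperRingedSpace

open SuperRingedSpace in
/-- A (super) vector field on the open set `U`: a section over `U` of the sheaf of superderivations,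
i.e. a family of `ℝ`-linear maps, compatible with restrictions, which satisfies the graded Leibniz
rule.  A vector field is a sum `D = D₀ + D₁` of an even and an odd derivation; as
`f ↦ conj (D (conj f))` is `D₀ - D₁`, the sum of the rules
`D_a (f g) = D_a f * g + (-1)^(a b) f * D_a g` (`f` of parity `b`) reads as below. -/
structure VectorField (M : SuperRingedSpace.{u}) (U : Opens M.carrier) where
  toFun : ∀ V : Opens M.carrier, V ≤ U → M.Sec V →ₗ[ℝ] M.Sec V
  res_toFun : ∀ (V V' : Opens M.carrier) (hV : V ≤ U) (h : V' ≤ V) (f : M.Sec V),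
    res h (toFun V hV f) = toFun V' (h.trans hV) (res h f)
  leibniz : ∀ (V : Opens M.carrier) (hV : V ≤ U) (b : ZMod 2) (f g : M.Sec V),
    IsHomogeneous f b →
      toFun V hV (f * g) = toFun V hV f * g + f * twist b V (toFun V hV (twist b V g))

namespace VectorField

open SuperRingedSpace

variable {M : SuperRingedSpace.{u}} {U : Opens M.carrier}

@[ext] theorem ext {X Y : VectorField M U} (h : ∀ V hV f, X.toFun V hV f = Y.toFun V hV f) :
    X = Y := by
  cases X; cases Y
  congr
  funext V hV
  exact LinearMap.ext (h V hV)

/-- The vector field applied to a function on `U` itself. -/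
def apply (X : VectorField M U) (f : M.Sec U) : M.Sec U := X.toFun U le_rfl f

/-- `X` is homogeneous of parity `a`: it maps functions of parity `b` to functions of parity
`a + b`. -/
def IsHomogeneous (X : VectorField M U) (a : ZMod 2) : Prop :=
  ∀ (V : Opens M.carrier) (hV : V ≤ U) (b : ZMod 2) (f : M.Sec V),
    SuperRingedSpace.IsHomogeneous f b → SuperRingedSpace.IsHomogeneous (X.toFun V hV f) (a + b)

/-- Restriction of a vector field to a smaller open set. -/
def restrict {V : Opens M.carrier} (h : V ≤ U) (X : VectorField M U) : VectorField M V where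
  toFun V' hV' := X.toFun V' (hV'.trans h)
  res_toFun V' V'' hV' h' f := X.res_toFun V' V'' (hV'.trans h) h' f
  leibniz V' hV' b f g hf := X.leibniz V' (hV'.trans h) b f g hf

instance : Add (VectorField M U) where
  add X Y :=
    { toFun := fun V hV => X.toFun V hV + Y.toFun V hV
      res_toFun := fun V V' hV h f => by simp [X.res_toFun, Y.res_toFun]
      leibniz := fun V hV b f g hf => by
        simp only [LinearMap.add_apply, X.leibniz V hV b f g hf, Y.leibniz V hV b f g hf, map_add,
          add_mul, mul_add]
        abel }

instance : Zero (VectorField M U) where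
  zero := { toFun := fun _ _ => 0, res_toFun := by simp, leibniz := by simp }

instance : Neg (VectorField M U) where
  neg X :=
    { toFun := fun V hV => -X.toFun V hV
      res_toFun := fun V V' hV h f => by simp [X.res_toFun]
      leibniz := fun V hV b f g hf => by
        simp only [LinearMap.neg_apply, X.leibniz V hV b f g hf, map_neg, neg_mul, mul_neg]
        abel }

@[simp] theorem add_toFun (X Y : VectorField M U) (V hV) (f : M.Sec V) :
    (X + Y).toFun V hV f = X.toFun V hV f + Y.toFun V hV f := rfl

@[simp] theorem zero_toFun (V hV) (f : M.Sec V) : (0 : VectorField M U).toFun V hV f = 0 := rfl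

@[simp] theorem neg_toFun (X : VectorField M U) (V hV) (f : M.Sec V) :
    (-X).toFun V hV f = -X.toFun V hV f := rfl

instance : AddCommGroup (VectorField M U) where
  add_assoc X Y Z := by ext; simp [add_assoc]
  zero_add X := by ext; simp
  add_zero X := by ext; simp
  nsmul := nsmulRec
  zsmul := zsmulRec
  neg_add_cancel X := by ext; simp
  add_comm X Y := by ext; simp [add_comm]

/-- `(f X)(g) = f · X(g)`. -/
instance : SMul (M.Sec U) (VectorField M U) where
  smul h X :=
    { toFun := fun V hV => LinearMap.mulLeft ℝ (res hV h) ∘ₗ X.toFun V hV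
      res_toFun := fun V V' hV h' f => by simp [X.res_toFun, res_res]
      leibniz := fun V hV b f g hf => by
        simp only [LinearMap.comp_apply, LinearMap.mulLeft_apply, X.leibniz V hV b f g hf, map_mul,
          mul_add, ← mul_assoc, mul_eq_mul_twist (res hV h) f hf] }

@[simp] theorem smul_toFun (h : M.Sec U) (X : VectorField M U) (V hV) (f : M.Sec V) :
    (h • X).toFun V hV f = res hV h * X.toFun V hV f := rfl

instance : Module (M.Sec U) (VectorField M U) where
  one_smul X := by ext; simp
  mul_smul f g X := by ext; simp [mul_assoc]
  smul_zero f := by ext; simp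
  smul_add f X Y := by ext; simp [mul_add]
  add_smul f g X := by ext; simp [add_mul]
  zero_smul X := by ext; simp

/-- The graded commutator `[X, Y] = X Y - (-1)^(a b) Y X` of vector fields of parities `a` and `b`,
as an operator on functions. -/
def bracket (a b : ZMod 2) (X Y : VectorField M U) (V : Opens M.carrier) (hV : V ≤ U) :
    M.Sec V →ₗ[ℝ] M.Sec V :=
  X.toFun V hV ∘ₗ Y.toFun V hV - sgn (a * b) • (Y.toFun V hV ∘ₗ X.toFun V hV)

end VectorField

namespace Grassmann

variable {p q : ℕ} {W : Opens (EuclideanSpace ℝ (Fin p))}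

/-- The standard coordinates `x_1, …, x_p, ξ_1, …, ξ_q` of `C^∞(W) ⊗ Λ(ξ_1, …, ξ_q)`. -/
noncomputable def stdCoord (i : Fin p ⊕ Fin q) : Grassmann (SmoothFun W) q :=
  Sum.elim (fun j => const (SmoothFun.coord j)) gen i

/-- The partial derivatives with respect to the standard coordinates. -/
noncomputable def stdPartial :
    Fin p ⊕ Fin q → Grassmann (SmoothFun W) q →ₗ[ℝ] Grassmann (SmoothFun W) q
  | Sum.inl j =>
    { toFun := evenDeriv (SmoothFun.pderiv j)
      map_add' := fun a b => by ext1 I; simp [evenDeriv]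
      map_smul' := fun r a => by ext1 I; simp [evenDeriv] }
  | Sum.inr j =>
    { toFun := oddDeriv j
      map_add' := fun a b => by
        ext1 I
        by_cases h : j ∈ I <;> simp [oddDeriv, h, mul_add]
      map_smul' := fun r a => by
        ext1 I
        by_cases h : j ∈ I <;> simp [oddDeriv, h] }

end Grassmann

/-- The domain of a local homeomorphism, as an open set. -/
def chartSource {X : Type*} [TopologicalSpace X] {p : ℕ}
    (φ : OpenPartialHomeomorph X (EuclideanSpace ℝ (Fin p))) : Opens X :=
  ⟨φ.source, φ.open_source⟩

/-- The image `φ(V)` of an open subset `V` of the domain of `φ`. -/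
def chartImage {X : Type*} [TopologicalSpace X] {p : ℕ}
    (φ : OpenPartialHomeomorph X (EuclideanSpace ℝ (Fin p))) (V : Opens X) :
    Opens (EuclideanSpace ℝ (Fin p)) :=
  ⟨φ.target ∩ φ.symm ⁻¹' V, φ.isOpen_inter_preimage_symm V.isOpen⟩

theorem chartImage_mono {X : Type*} [TopologicalSpace X] {p : ℕ}
    (φ : OpenPartialHomeomorph X (EuclideanSpace ℝ (Fin p))) {V V' : Opens X} (h : V' ≤ V) :
    chartImage φ V' ≤ chartImage φ V := fun _ hw => ⟨hw.1, h hw.2⟩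

namespace SuperRingedSpace

/-- A chart of dimension `p|q` (a system of `p` even and `q` odd local coordinates): an isomorphism
of superringed spaces of an open subset `U` of `M` with an open subset `W` of `ℝ^p` carrying the
sheaf `C^∞ ⊗ Λ(ξ_1, …, ξ_q)`; that is, a homeomorphism `φ : U → W` and isomorphisms
`𝒪(V) ≃ C^∞(φ(V)) ⊗ Λ(ξ_1, …, ξ_q)` of superalgebras for the open subsets `V` of `U`,
compatible with restrictions. -/
structure Chart (M : SuperRingedSpace.{u}) (p q : ℕ) where
  homeo : OpenPartialHomeomorph M.carrier (EuclideanSpace ℝ (Fin p))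
  iso : ∀ V : Opens M.carrier, V ≤ chartSource homeo →
    (M.Sec V ≃ₐ[ℝ] Grassmann (SmoothFun (chartImage homeo V)) q)
  iso_res : ∀ (V V' : Opens M.carrier) (hV : V ≤ chartSource homeo) (h : V' ≤ V) (f : M.Sec V)
    (I : Finset (Fin q)) (w : chartImage homeo V'),
    iso V' (h.trans hV) (res h f) I w = iso V hV f I ⟨w, chartImage_mono homeo h w.2⟩
  iso_conj : ∀ (V : Opens M.carrier) (hV : V ≤ chartSource homeo) (f : M.Sec V),
    iso V hV (conj V f) = Grassmann.conj (iso V hV f)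

namespace Chart

variable {M : SuperRingedSpace.{u}} {p q : ℕ} (χ : M.Chart p q)

/-- The domain of the chart. -/
abbrev source : Opens M.carrier := chartSource χ.homeo

/-- The coordinates `x^i` of the chart, as superfunctions on its domain. -/
noncomputable def coord (i : Fin p ⊕ Fin q) : M.Sec χ.source :=
  (χ.iso χ.source le_rfl).symm (Grassmann.stdCoord i)

theorem stdPartial_res {V V' : Opens M.carrier} (hV : V ≤ chartSource χ.homeo) (h : V' ≤ V)
    (i : Fin p ⊕ Fin q) (f : M.Sec V) (I : Finset (Fin q)) (w : chartImage χ.homeo V') :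
    Grassmann.stdPartial i (χ.iso V' (h.trans hV) (res h f)) I w =
      Grassmann.stdPartial i (χ.iso V hV f) I ⟨w, chartImage_mono χ.homeo h w.2⟩ := by
  rcases i with j | j
  · change SmoothFun.pderiv j (χ.iso V' (h.trans hV) (res h f) I) w =
      SmoothFun.pderiv j (χ.iso V hV f I) ⟨w, chartImage_mono χ.homeo h w.2⟩
    rw [SmoothFun.pderiv_apply, SmoothFun.pderiv_apply]
    congr 1
    refine (SmoothFun.extend_eventuallyEq (fun v => ?_) w).fderiv_eq (𝕜 := ℝ)
    rw [χ.iso_res V V' hV h f I v]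
    exact (SmoothFun.extend_coe (χ.iso V hV f I) ⟨v, chartImage_mono χ.homeo h v.2⟩).symm
  · change Grassmann.oddDeriv j (χ.iso V' (h.trans hV) (res h f)) I w =
      Grassmann.oddDeriv j (χ.iso V hV f) I ⟨w, chartImage_mono χ.homeo h w.2⟩
    by_cases hj : j ∈ I
    · simp [Grassmann.oddDeriv, hj]
    · rcases Nat.even_or_odd (inversions {j} I) with e' | e' <;>
        simp [Grassmann.oddDeriv, hj, e'.neg_one_pow, χ.iso_res V V' hV h f]

/-- The coordinate vector field `∂/∂x^i` on the domain of the chart. -/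
noncomputable def coordField (i : Fin p ⊕ Fin q) : VectorField M χ.source where
  toFun V hV :=
    (χ.iso V hV).symm.toLinearMap ∘ₗ Grassmann.stdPartial i ∘ₗ (χ.iso V hV).toLinearMap
  res_toFun V V' hV h f := by
    apply (χ.iso V' (h.trans hV)).injective
    ext I w
    simp [χ.iso_res V V' hV h, χ.stdPartial_res hV h]
  leibniz V hV b f g hf := by
    apply (χ.iso V hV).injective
    have hF : Grassmann.conj (χ.iso V hV f) = sgn b • χ.iso V hV f := by
      rw [← χ.iso_conj, show conj V f = sgn b • f from hf, map_smul]
    rcases zmod_two b with rfl | rfl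
    · have hF' : Grassmann.conj (χ.iso V hV f) = χ.iso V hV f := by simpa [sgn] using hF
      rcases i with j | j
      · simp [twist_zero, Grassmann.stdPartial, Grassmann.evenDeriv_mul]
      · simp [twist_zero, Grassmann.stdPartial, Grassmann.oddDeriv_mul, hF']
    · have hF' : Grassmann.conj (χ.iso V hV f) = -χ.iso V hV f := by simpa [sgn] using hF
      rcases i with j | j
      · simp [twist_one, Grassmann.stdPartial, Grassmann.evenDeriv_mul, χ.iso_conj,
          Grassmann.evenDeriv_conj, Grassmann.conj_conj]
      · simp [twist_one, Grassmann.stdPartial, Grassmann.oddDeriv_mul, hF', χ.iso_conj,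
          Grassmann.oddDeriv_conj, Grassmann.conj_conj]

end Chart
end SuperRingedSpace

/-- A supermanifold of dimension `p|q`: a Hausdorff second countable space with a sheaf of
superalgebras which is locally isomorphic to `C^∞ ⊗ Λ(ξ_1, …, ξ_q)` on open subsets of `ℝ^p`. -/
structure Supermanifold (p q : ℕ) extends SuperRingedSpace.{u} where
  t2Space : T2Space carrier
  secondCountableTopology : SecondCountableTopology carrier
  exists_chart : ∀ m : carrier,
    ∃ χ : SuperRingedSpace.Chart toSuperRingedSpace p q, m ∈ χ.source

namespace Supermanifold

open SuperRingedSpace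

variable {p q : ℕ} (M : Supermanifold.{u} p q)

/-- The vector fields `Γ(TU)` on the open set `U`. -/
abbrev VF (U : Opens M.carrier) : Type u := VectorField M.toSuperRingedSpace U

/-- A metric: an even, graded symmetric, nondegenerate section `g` of `T*M ⊗ T*M`, given by its
values `g(X, Y)` on the vector fields `X`, `Y` over open sets.  It is left bilinear over the
superfunctions, and nondegenerate in the sense that its matrix in every chart is invertible. -/
structure Metric where
  toFun : ∀ U : Opens M.carrier, M.VF U → M.VF U → M.Sec U
  res_toFun : ∀ (U V : Opens M.carrier) (h : V ≤ U) (X Y : M.VF U),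
    res h (toFun U X Y) = toFun V (X.restrict h) (Y.restrict h)
  add_left : ∀ (U : Opens M.carrier) (X X' Y : M.VF U),
    toFun U (X + X') Y = toFun U X Y + toFun U X' Y
  add_right : ∀ (U : Opens M.carrier) (X Y Y' : M.VF U),
    toFun U X (Y + Y') = toFun U X Y + toFun U X Y'
  smul_left : ∀ (U : Opens M.carrier) (f : M.Sec U) (X Y : M.VF U),
    toFun U (f • X) Y = f * toFun U X Y
  smul_right : ∀ (U : Opens M.carrier) (f : M.Sec U) (X Y : M.VF U) (a b : ZMod 2),
    X.IsHomogeneous a → IsHomogeneous f b →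
      toFun U X (f • Y) = sgn (a * b) • (f * toFun U X Y)
  even : ∀ (U : Opens M.carrier) (X Y : M.VF U) (a b : ZMod 2),
    X.IsHomogeneous a → Y.IsHomogeneous b → IsHomogeneous (toFun U X Y) (a + b)
  symm : ∀ (U : Opens M.carrier) (X Y : M.VF U) (a b : ZMod 2),
    X.IsHomogeneous a → Y.IsHomogeneous b → toFun U Y X = sgn (a * b) • toFun U X Y
  nondegenerate : ∀ χ : M.Chart p q,
    IsUnit (Matrix.of fun i j => toFun χ.source (χ.coordField i) (χ.coordField j))

variable {M}

namespace Metric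

/-- The matrix `g_{ij} = g(∂/∂x^i, ∂/∂x^j)` in a chart. -/
noncomputable def matrix (g : M.Metric) (χ : M.Chart p q) :
    Matrix (Fin p ⊕ Fin q) (Fin p ⊕ Fin q) (M.Sec χ.source) :=
  Matrix.of fun i j => g.toFun χ.source (χ.coordField i) (χ.coordField j)

/-- The inverse matrix `g^{ij}`. -/
noncomputable def invMatrix (g : M.Metric) (χ : M.Chart p q) :
    Matrix (Fin p ⊕ Fin q) (Fin p ⊕ Fin q) (M.Sec χ.source) :=
  ((g.nondegenerate χ).unit⁻¹ : (Matrix (Fin p ⊕ Fin q) (Fin p ⊕ Fin q) (M.Sec χ.source))ˣ)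

theorem matrix_mul_invMatrix (g : M.Metric) (χ : M.Chart p q) :
    g.matrix χ * g.invMatrix χ = 1 := (g.nondegenerate χ).mul_val_inv

theorem invMatrix_mul_matrix (g : M.Metric) (χ : M.Chart p q) :
    g.invMatrix χ * g.matrix χ = 1 := (g.nondegenerate χ).val_inv_mul

end Metric

variable (M) in
/-- An (even) connection in the tangent bundle of the open subset `U` of `M`. -/
structure Connection (U : Opens M.carrier) where
  toFun : M.VF U → M.VF U → M.VF U
  add_left : ∀ X X' Y, toFun (X + X') Y = toFun X Y + toFun X' Y
  add_right : ∀ X Y Y', toFun X (Y + Y') = toFun X Y + toFun X Y'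
  smul_left : ∀ (f : M.Sec U) (X Y : M.VF U), toFun (f • X) Y = f • toFun X Y
  leibniz : ∀ (f : M.Sec U) (X Y : M.VF U) (a b : ZMod 2),
    X.IsHomogeneous a → IsHomogeneous f b →
      toFun X (f • Y) = X.apply f • Y + (sgn (a * b) • f) • toFun X Y
  even : ∀ (X Y : M.VF U) (a b : ZMod 2),
    X.IsHomogeneous a → Y.IsHomogeneous b → (toFun X Y).IsHomogeneous (a + b)

namespace Connection

variable {U : Opens M.carrier}

/-- The torsion `T(X, Y) = ∇_X Y - (-1)^(a b) ∇_Y X - [X, Y]` vanishes for all homogeneous vector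
fields `X`, `Y` of parities `a`, `b`. -/
def IsTorsionFree (D : M.Connection U) : Prop :=
  ∀ (X Y : M.VF U) (a b : ZMod 2), X.IsHomogeneous a → Y.IsHomogeneous b →
    ∀ (V : Opens M.carrier) (hV : V ≤ U),
      (D.toFun X Y).toFun V hV - sgn (a * b) • (D.toFun Y X).toFun V hV -
        VectorField.bracket a b X Y V hV = 0

/-- `X(g(Y, Z)) = g(∇_X Y, Z) + (-1)^(a b) g(Y, ∇_X Z)` for all homogeneous vector fields `X`, `Y`,
`Z`, where `a`, `b` are the parities of `X`, `Y`. -/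
def IsCompatible (D : M.Connection U) (g : M.Metric) : Prop :=
  ∀ (X Y Z : M.VF U) (a b c : ZMod 2),
    X.IsHomogeneous a → Y.IsHomogeneous b → Z.IsHomogeneous c →
      X.apply (g.toFun U Y Z) =
        g.toFun U (D.toFun X Y) Z + sgn (a * b) • g.toFun U Y (D.toFun X Z)

/-- The connection `D'` on `V` is the restriction of the connection `D` on `U`. -/
def IsRestriction {V : Opens M.carrier} (D : M.Connection U) (h : V ≤ U) (D' : M.Connection V) :
    Prop :=
  ∀ X Y : M.VF U, D'.toFun (X.restrict h) (Y.restrict h) = (D.toFun X Y).restrict h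

/-- The Christoffel symbol `Γ_{jk}^i`, the `i`-th component of `∇_{∂/∂x^j} ∂/∂x^k`. -/
noncomputable def christoffel {χ : M.Chart p q} (D : M.Connection χ.source)
    (i j k : Fin p ⊕ Fin q) : M.Sec χ.source :=
  (D.toFun (χ.coordField j) (χ.coordField k)).apply (χ.coord i)

end Connection

end Supermanifold

/-! The proof is the classical Koszul argument with signs. For homogeneous fields of parities `a`,
`b`, `c`, torsion-freeness and compatibility force `2 g(∇_X Y, Z) = K(X, Y, Z)`, where `K`
(`koszul`) involves only `g`, derivatives of inner products and graded brackets. Since `g` is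
nondegenerate, this determines `∇_X Y`.

Conversely, `K` is graded linear over the superfunctions in `Z` (`koszul_smul_right`). In a chart it
can therefore be solved against the coordinate frame with the inverse matrix of `g`. The solutions
are unique, so they agree on overlaps and glue (`exists_isKoszul`). Linearity of `K` in `X` and its
Leibniz rule in `Y` (`koszul_smul_left`, `koszul_smul_mid`) make the solution a connection.
Antisymmetrizing `K` in `X`, `Y` leaves `2 g([X, Y], Z)`, which gives vanishing torsion.
Symmetrizing it in `Y`, `Z` leaves `2 X(g(Y, Z))`, which gives compatibility. The signs depend on
parities, so everything is proved for homogeneous arguments and extended additively.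

Two facts about supermanifolds support this. First, in a chart `X = ∑ X(x^i) ∂/∂x^i`
(`sum_apply_smul_frame`). Vector fields are bare superderivations, so one must show that a
derivation killing the coordinates is zero. Hadamard's lemma handles functions of the even
coordinates, and induction on monomials handles the odd ones. Second, even bump functions exist
(`exists_bump`). They extend frame fields to global fields, so that global test fields `Z` suffice
for uniqueness. They also show that a connection is local in both arguments, so that its restriction
to an open set is unique.

The construction works over every open set and commutes with restriction (`restrict_nabla`), so the
restriction to a chart domain is the connection built there. Coordinate fields have vanishing
brackets. In `K` only the three derivative terms survive, and multiplication by the inverse matrix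
gives the Christoffel symbols. -/

section Hadamard

/-! ### Hadamard's lemma -/

open MeasureTheory

/-- The integral over `[0, 1]` of a smooth family of functions depends smoothly on the parameter. -/
theorem contDiff_integral_unitInterval {P E : Type*} [NormedAddCommGroup P] [NormedSpace ℝ P]
    [NormedAddCommGroup E] [NormedSpace ℝ E] [CompleteSpace E] {H : P × ℝ → E}
    (hH : ContDiff ℝ ∞ H) : ContDiff ℝ ∞ fun x => ∫ t in (0 : ℝ)..1, H (x, t) := by
  -- The integral is the value at `0` of the convolution of the indicator of `(0, 1]` with `s ↦ H
  -- (x, -s)`. The bump, equal to `1` for `|s| ≤ 2` and to `0` for `|s| ≥ 3`, does not change this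
  -- value and provides the compact support needed for smoothness in the parameter.
  let χ : ContDiffBump (0 : ℝ) := ⟨2, 3, by norm_num, by norm_num⟩
  let f : ℝ → ℝ := Set.indicator (Set.Ioc 0 1) fun _ => 1
  have hf : LocallyIntegrable f volume :=
    ((integrable_indicator_iff measurableSet_Ioc).2 (by simp)).locallyIntegrable
  have key := contDiffOn_convolution_right_with_param_comp (n := ⊤) (μ := volume)
    (ContinuousLinearMap.lsmul ℝ ℝ : ℝ →L[ℝ] E →L[ℝ] E) (s := Set.univ)
    (v := fun _ : P => (0 : ℝ)) contDiffOn_const (f := f)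
    (g := fun x s => χ s • H (x, -s)) (k := Metric.closedBall 0 3) isOpen_univ
    (isCompact_closedBall _ _) (fun p x _ hx => by
      rw [χ.zero_of_le_dist (not_le.1 fun h => hx h).le, zero_smul]) hf
    (ContDiff.contDiffOn (by
      refine ContDiff.smul (χ.contDiff.comp contDiff_snd) (hH.comp ?_)
      exact contDiff_fst.prodMk contDiff_snd.neg))
  convert! contDiffOn_univ.1 key using 1
  funext x
  rw [intervalIntegral.integral_of_le zero_le_one, convolution_def,
    ← integral_indicator measurableSet_Ioc]
  refine integral_congr_ae (.of_forall fun t => ?_)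
  by_cases ht : t ∈ Set.Ioc (0 : ℝ) 1
  · have : χ (-t) = 1 := χ.one_of_mem_closedBall (by
      simp only [Metric.mem_closedBall, dist_zero_right, norm_neg, Real.norm_eq_abs]
      exact (abs_le.2 ⟨by linarith [ht.1], by linarith [ht.2]⟩ : |t| ≤ 2))
    simp [f, ht, this]
  · simp [f, ht]

/-- Hadamard's lemma. -/
theorem exists_contDiff_eq_add_sum {p : ℕ} {F : EuclideanSpace ℝ (Fin p) → ℝ}
    (hF : ContDiff ℝ ∞ F) (w : EuclideanSpace ℝ (Fin p)) :
    ∃ b : Fin p → EuclideanSpace ℝ (Fin p) → ℝ, (∀ j, ContDiff ℝ ∞ (b j)) ∧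
      ∀ x, F x = F w + ∑ j, (x j - w j) * b j x := by
  have hγ : ∀ x : EuclideanSpace ℝ (Fin p), ∀ t : ℝ,
      HasDerivAt (fun t : ℝ => F (w + t • (x - w))) (fderiv ℝ F (w + t • (x - w)) (x - w)) t := by
    intro x t
    have h1 : HasDerivAt (fun t : ℝ => w + t • (x - w)) (x - w) t := by
      simpa using ((hasDerivAt_id t).smul_const (x - w)).const_add w
    exact ((hF.differentiable (by simp)) _).hasFDerivAt.comp_hasDerivAt t h1
  have hH : ∀ v : EuclideanSpace ℝ (Fin p), ContDiff ℝ ∞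
      fun y : EuclideanSpace ℝ (Fin p) × ℝ => fderiv ℝ F (w + y.2 • (y.1 - w)) v := by
    intro v
    refine ContDiff.clm_apply ((hF.fderiv_right (m := ∞) (by simp)).comp ?_) contDiff_const
    exact contDiff_const.add (contDiff_snd.smul (contDiff_fst.sub contDiff_const))
  -- The coefficients are the partial derivatives averaged along the segment from `w` to `x`; the
  -- identity is the fundamental theorem of calculus on that segment.
  refine ⟨fun j x => ∫ t in (0 : ℝ)..1,
    fderiv ℝ F (w + t • (x - w)) (EuclideanSpace.single j (1 : ℝ)),
    fun j => contDiff_integral_unitInterval (hH _), fun x => ?_⟩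
  have hcont : ∀ v : EuclideanSpace ℝ (Fin p), Continuous
      fun t : ℝ => fderiv ℝ F (w + t • (x - w)) v := fun v =>
    (hH v).continuous.comp (Continuous.prodMk continuous_const continuous_id)
  have h := intervalIntegral.integral_eq_sub_of_hasDerivAt (fun t _ => hγ x t)
    ((hcont (x - w)).intervalIntegrable 0 1)
  have hx : x - w = ∑ j, (x j - w j) • EuclideanSpace.single j (1 : ℝ) := by
    ext i
    simp [Finset.sum_apply, Pi.single_apply]
  have h2 : ∀ t : ℝ, fderiv ℝ F (w + t • (x - w)) (x - w) = ∑ j, (x j - w j) *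
      fderiv ℝ F (w + t • (x - w)) (EuclideanSpace.single j (1 : ℝ)) := by
    intro t
    conv_lhs => enter [2]; rw [hx]
    simp [map_sum]
  simp only [h2] at h
  rw [intervalIntegral.integral_finsetSum fun j _ =>
    ((hcont _).const_mul _).intervalIntegrable 0 1] at h
  simp only [intervalIntegral.integral_const_mul, one_smul, zero_smul, add_zero,
    add_sub_cancel] at h
  linarith

end Hadamard

/-! ### Signs -/

section Sign

@[simp] theorem sgn_zero : sgn 0 = 1 := rfl

@[simp] theorem sgn_one : sgn 1 = -1 := by simp [sgn]

theorem sgn_add (a b : ZMod 2) : sgn (a + b) = sgn a * sgn b := by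
  rcases SuperRingedSpace.zmod_two a with rfl | rfl <;>
    rcases SuperRingedSpace.zmod_two b with rfl | rfl <;>
    simp [show (1 : ZMod 2) + 1 = 0 from rfl]

@[simp] theorem sgn_mul_self (a : ZMod 2) : sgn a * sgn a = 1 := by
  rcases SuperRingedSpace.zmod_two a with rfl | rfl <;> simp

theorem smul_sgn_smul {E : Type*} [AddCommGroup E] [Module ℝ E] (a : ZMod 2) (x : E) :
    sgn a • sgn a • x = x := by
  rw [smul_smul, sgn_mul_self, one_smul]

end Sign

/-! ### Homogeneous superfunctions -/

namespace SuperRingedSpace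

variable {M : SuperRingedSpace.{u}} {U V : Opens M.carrier}

theorem IsHomogeneous.add {f g : M.Sec U} {a : ZMod 2} (hf : IsHomogeneous f a)
    (hg : IsHomogeneous g a) : IsHomogeneous (f + g) a := by
  unfold IsHomogeneous at *
  rw [map_add, hf, hg, smul_add]

theorem IsHomogeneous.smul {f : M.Sec U} {a : ZMod 2} (hf : IsHomogeneous f a) (r : ℝ) :
    IsHomogeneous (r • f) a := by
  unfold IsHomogeneous at *
  rw [map_smul, hf, smul_comm]

theorem IsHomogeneous.res {f : M.Sec U} {a : ZMod 2} (hf : IsHomogeneous f a) (h : V ≤ U) :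
    IsHomogeneous (SuperRingedSpace.res h f) a := by
  unfold IsHomogeneous at *
  rw [← res_conj, hf, map_smul]

theorem isHomogeneous_algebraMap (r : ℝ) : IsHomogeneous (algebraMap ℝ (M.Sec U) r) 0 := by
  simp [IsHomogeneous]

/-- The component of parity `a` of a superfunction. -/
noncomputable def part (a : ZMod 2) (f : M.Sec U) : M.Sec U := (1 / 2 : ℝ) • (f + sgn a • conj U f)

theorem isHomogeneous_part (a : ZMod 2) (f : M.Sec U) : IsHomogeneous (part a f) a := by
  simp only [IsHomogeneous, part, map_smul, map_add, conj_conj]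
  rw [smul_comm (sgn a) (1 / 2 : ℝ), smul_add (sgn a), smul_sgn_smul, add_comm]

theorem part_zero_add_part_one (f : M.Sec U) : part 0 f + part 1 f = f := by
  simp only [part, sgn_zero, sgn_one]
  module

/-- Homogeneous superfunctions span the superfunctions. -/
theorem sec_induction {P : M.Sec U → Prop} (homogeneous : ∀ a f, IsHomogeneous f a → P f)
    (add : ∀ f g, P f → P g → P (f + g)) (f : M.Sec U) : P f := by
  rw [← part_zero_add_part_one f]
  exact add _ _ (homogeneous _ _ (isHomogeneous_part _ _)) (homogeneous _ _ (isHomogeneous_part _ _))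

theorem twist_conj (b : ZMod 2) (f : M.Sec U) : twist b U (conj U f) = conj U (twist b U f) := by
  rcases zmod_two b with rfl | rfl
  · rfl
  · simp [twist_one]

end SuperRingedSpace

/-! ### Vector fields: real scalars, parity, graded bracket -/

namespace VectorField

open SuperRingedSpace

variable {M : SuperRingedSpace.{u}} {U V W : Opens M.carrier}

/-- Evaluation of vector fields on a superfunction. -/
def evalHom (V : Opens M.carrier) (hV : V ≤ U) (f : M.Sec V) : VectorField M U →+ M.Sec V where
  toFun X := X.toFun V hV f
  map_zero' := rfl
  map_add' _ _ := rfl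

theorem sum_toFun {ι : Type*} (s : Finset ι) (X : ι → VectorField M U) (V hV) (f : M.Sec V) :
    (∑ i ∈ s, X i).toFun V hV f = ∑ i ∈ s, (X i).toFun V hV f :=
  map_sum (evalHom V hV f) X s

@[simp] theorem sub_toFun (X Y : VectorField M U) (V hV) (f : M.Sec V) :
    (X - Y).toFun V hV f = X.toFun V hV f - Y.toFun V hV f :=
  map_sub (evalHom V hV f) X Y

noncomputable instance : Module ℝ (VectorField M U) := Module.compHom _ (algebraMap ℝ (M.Sec U))

theorem real_smul_def (r : ℝ) (X : VectorField M U) : r • X = algebraMap ℝ (M.Sec U) r • X := rfl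

@[simp] theorem real_smul_toFun (r : ℝ) (X : VectorField M U) (V hV) (f : M.Sec V) :
    (r • X).toFun V hV f = r • X.toFun V hV f := by
  rw [real_smul_def, smul_toFun, AlgHom.commutes, Algebra.smul_def]

instance : IsScalarTower ℝ (M.Sec U) (VectorField M U) :=
  ⟨fun r f X => by ext; simp⟩

/-- Restriction of vector fields as a homomorphism. -/
def restrictHom (h : V ≤ U) : VectorField M U →+ VectorField M V where
  toFun X := X.restrict h
  map_zero' := rfl
  map_add' _ _ := rfl

@[simp] theorem restrict_add (h : V ≤ U) (X Y : VectorField M U) :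
    (X + Y).restrict h = X.restrict h + Y.restrict h := rfl

@[simp] theorem restrict_sub (h : V ≤ U) (X Y : VectorField M U) :
    (X - Y).restrict h = X.restrict h - Y.restrict h := map_sub (restrictHom h) X Y

@[simp] theorem restrict_smul (h : V ≤ U) (f : M.Sec U) (X : VectorField M U) :
    (f • X).restrict h = res h f • X.restrict h := by
  ext V' hV' g
  change res _ f * _ = res _ (res h f) * _
  rw [res_res]
  rfl

@[simp] theorem restrict_real_smul (h : V ≤ U) (r : ℝ) (X : VectorField M U) :
    (r • X).restrict h = r • X.restrict h := by
  rw [real_smul_def, restrict_smul, AlgHom.commutes, real_smul_def]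

theorem restrict_restrict (h : V ≤ U) (h' : W ≤ V) (X : VectorField M U) :
    (X.restrict h).restrict h' = X.restrict (h'.trans h) := rfl

theorem restrict_self (X : VectorField M U) : X.restrict le_rfl = X := rfl

theorem res_apply (h : V ≤ U) (X : VectorField M U) (f : M.Sec U) :
    res h (X.apply f) = (X.restrict h).apply (res h f) := X.res_toFun _ _ _ _ _

theorem apply_restrict (h : V ≤ U) (X : VectorField M U) (f : M.Sec V) :
    (X.restrict h).apply f = X.toFun V h f := rfl

@[simp] theorem add_apply (X Y : VectorField M U) (f : M.Sec U) :
    (X + Y).apply f = X.apply f + Y.apply f := rfl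

@[simp] theorem smul_apply (h : M.Sec U) (X : VectorField M U) (f : M.Sec U) :
    (h • X).apply f = h * X.apply f := by
  simp [apply, res_self]

theorem sum_apply {ι : Type*} (s : Finset ι) (X : ι → VectorField M U) (f : M.Sec U) :
    (∑ i ∈ s, X i).apply f = ∑ i ∈ s, (X i).apply f := sum_toFun s X U le_rfl f

@[simp] theorem apply_add (X : VectorField M U) (f g : M.Sec U) :
    X.apply (f + g) = X.apply f + X.apply g := map_add _ _ _

@[simp] theorem apply_real_smul (X : VectorField M U) (r : ℝ) (f : M.Sec U) :
    X.apply (r • f) = r • X.apply f := map_smul _ _ _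

theorem leibniz_of_even (X : VectorField M U) (hV : V ≤ U) {f : M.Sec V}
    (hf : SuperRingedSpace.IsHomogeneous f 0) (g : M.Sec V) :
    X.toFun V hV (f * g) = X.toFun V hV f * g + f * X.toFun V hV g := by
  simpa [twist_zero] using X.leibniz V hV 0 f g hf

theorem toFun_one (X : VectorField M U) (hV : V ≤ U) : X.toFun V hV 1 = 0 := by
  have := X.leibniz_of_even hV (f := 1) (by simp [SuperRingedSpace.IsHomogeneous]) 1
  simpa using this

theorem toFun_algebraMap (X : VectorField M U) (hV : V ≤ U) (r : ℝ) :
    X.toFun V hV (algebraMap ℝ (M.Sec V) r) = 0 := by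
  rw [Algebra.algebraMap_eq_smul_one, map_smul, toFun_one, smul_zero]

/-- Conjugation in the odd part: `X₀ + X₁ ↦ X₀ - X₁`. -/
def conj (X : VectorField M U) : VectorField M U where
  toFun V hV := (SuperRingedSpace.conj V).toLinearMap ∘ₗ X.toFun V hV ∘ₗ
    (SuperRingedSpace.conj V).toLinearMap
  res_toFun V V' hV h f := by simp [res_conj, X.res_toFun]
  leibniz V hV b f g hf := by
    have h : SuperRingedSpace.IsHomogeneous (SuperRingedSpace.conj V f) b := by
      have hf' : SuperRingedSpace.conj V f = sgn b • f := hf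
      rw [hf']
      exact hf.smul _
    simp [X.leibniz V hV b _ _ h, twist_conj, conj_conj]

theorem conj_toFun (X : VectorField M U) (hV : V ≤ U) (f : M.Sec V) :
    X.conj.toFun V hV f = SuperRingedSpace.conj V (X.toFun V hV (SuperRingedSpace.conj V f)) := rfl

@[simp] theorem conj_add (X Y : VectorField M U) : (X + Y).conj = X.conj + Y.conj := by
  ext; simp [conj_toFun]

@[simp] theorem conj_smul (f : M.Sec U) (X : VectorField M U) :
    (f • X).conj = SuperRingedSpace.conj U f • X.conj := by
  ext; simp [conj_toFun, res_conj]

@[simp] theorem conj_real_smul (r : ℝ) (X : VectorField M U) : (r • X).conj = r • X.conj := by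
  ext; simp [conj_toFun]

@[simp] theorem conj_conj (X : VectorField M U) : X.conj.conj = X := by
  ext; simp [conj_toFun, SuperRingedSpace.conj_conj]

theorem restrict_conj (h : V ≤ U) (X : VectorField M U) :
    X.conj.restrict h = (X.restrict h).conj := rfl

/-- On `f` of parity `b` the two conjugations contribute `sgn b` and `sgn (a + b)`, whose product is
`sgn a`. The parity of a field thus becomes a single equation, which can be tested by inner
products. -/
theorem isHomogeneous_iff {X : VectorField M U} {a : ZMod 2} :
    X.IsHomogeneous a ↔ X.conj = sgn a • X := by
  constructor
  · intro h
    ext V hV f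
    rw [conj_toFun, real_smul_toFun]
    refine sec_induction (P := fun f => SuperRingedSpace.conj V
      (X.toFun V hV (SuperRingedSpace.conj V f)) = sgn a • X.toFun V hV f) ?_ ?_ f
    · intro b f hf
      have h1 : SuperRingedSpace.conj V f = sgn b • f := hf
      have h2 : SuperRingedSpace.conj V (X.toFun V hV f) = sgn (a + b) • X.toFun V hV f :=
        h V hV b f hf
      rw [h1, map_smul, map_smul, h2, sgn_add, mul_comm, mul_smul, smul_sgn_smul]
    · intro f g hf hg
      rw [map_add, map_add, map_add, hf, hg, map_add, smul_add]
  · intro h V hV b f hf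
    have h1 : SuperRingedSpace.conj V f = sgn b • f := hf
    have h2 := conj_toFun X hV (SuperRingedSpace.conj V f)
    rw [SuperRingedSpace.conj_conj, h, real_smul_toFun, h1, map_smul] at h2
    rw [SuperRingedSpace.IsHomogeneous, ← h2, sgn_add, mul_smul]

theorem IsHomogeneous.conj_eq {X : VectorField M U} {a : ZMod 2} (h : X.IsHomogeneous a) :
    X.conj = sgn a • X := isHomogeneous_iff.1 h

theorem IsHomogeneous.smul {f : M.Sec U} {X : VectorField M U} {a b : ZMod 2}
    (hX : X.IsHomogeneous a) (hf : SuperRingedSpace.IsHomogeneous f b) :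
    (f • X).IsHomogeneous (b + a) := by
  rw [isHomogeneous_iff] at *
  have hf' : SuperRingedSpace.conj U f = sgn b • f := hf
  rw [conj_smul, hX, hf', sgn_add, mul_smul, smul_assoc, smul_comm f]

theorem IsHomogeneous.restrict {X : VectorField M U} {a : ZMod 2} (hX : X.IsHomogeneous a)
    (h : V ≤ U) : (X.restrict h).IsHomogeneous a := fun V' hV' => hX V' (hV'.trans h)

theorem IsHomogeneous.apply {X : VectorField M U} {a b : ZMod 2} (hX : X.IsHomogeneous a)
    {f : M.Sec U} (hf : SuperRingedSpace.IsHomogeneous f b) :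
    SuperRingedSpace.IsHomogeneous (X.apply f) (a + b) := hX U le_rfl b f hf

/-- The graded Leibniz rule for homogeneous vector fields. -/
theorem IsHomogeneous.toFun_mul {X : VectorField M U} {a b : ZMod 2} (hX : X.IsHomogeneous a)
    (hV : V ≤ U) {f : M.Sec V} (hf : SuperRingedSpace.IsHomogeneous f b) (g : M.Sec V) :
    X.toFun V hV (f * g) = X.toFun V hV f * g + sgn (a * b) • (f * X.toFun V hV g) := by
  rw [X.leibniz V hV b f g hf]
  rcases zmod_two b with rfl | rfl
  · simp [twist_zero]
  · rw [twist_one, twist_one, ← conj_toFun, hX.conj_eq, real_smul_toFun, mul_one, mul_smul_comm]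

theorem IsHomogeneous.apply_mul {X : VectorField M U} {a b : ZMod 2} (hX : X.IsHomogeneous a)
    {f : M.Sec U} (hf : SuperRingedSpace.IsHomogeneous f b) (g : M.Sec U) :
    X.apply (f * g) = X.apply f * g + sgn (a * b) • (f * X.apply g) := hX.toFun_mul le_rfl hf g

/-- The component of parity `a` of a vector field. -/
noncomputable def part (a : ZMod 2) (X : VectorField M U) : VectorField M U :=
  (1 / 2 : ℝ) • (X + sgn a • X.conj)

theorem isHomogeneous_part (a : ZMod 2) (X : VectorField M U) : (part a X).IsHomogeneous a := by
  simp only [isHomogeneous_iff, part, conj_real_smul, conj_add, conj_conj]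
  rw [smul_comm (sgn a) (1 / 2 : ℝ), smul_add (sgn a), smul_sgn_smul, add_comm]

theorem part_zero_add_part_one (X : VectorField M U) : part 0 X + part 1 X = X := by
  simp only [part, sgn_zero, sgn_one]
  module

theorem part_add (a : ZMod 2) (X Y : VectorField M U) : part a (X + Y) = part a X + part a Y := by
  simp only [part, conj_add]
  module

theorem IsHomogeneous.part_eq {X : VectorField M U} {a : ZMod 2} (hX : X.IsHomogeneous a)
    (b : ZMod 2) : part b X = if b = a then X else 0 := by
  rw [part, hX.conj_eq]
  split_ifs with h
  · rw [h, smul_sgn_smul]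
    module
  · have : sgn b * sgn a = -1 := by
      rcases zmod_two a with rfl | rfl <;> rcases zmod_two b with rfl | rfl <;> simp_all
    rw [smul_smul, this]
    module

theorem IsHomogeneous.part_self {X : VectorField M U} {a : ZMod 2} (hX : X.IsHomogeneous a) :
    part a X = X := by
  rw [hX.part_eq, if_pos rfl]

theorem restrict_part (h : V ≤ U) (a : ZMod 2) (X : VectorField M U) :
    (part a X).restrict h = part a (X.restrict h) := by
  simp [part, restrict_conj]

/-- Homogeneous vector fields span the vector fields. -/
theorem homogeneous_induction {P : VectorField M U → Prop}
    (homogeneous : ∀ a X, X.IsHomogeneous a → P X) (add : ∀ X Y, P X → P Y → P (X + Y))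
    (X : VectorField M U) : P X := by
  rw [← part_zero_add_part_one X]
  exact add _ _ (homogeneous _ _ (isHomogeneous_part _ _)) (homogeneous _ _ (isHomogeneous_part _ _))

/-- The graded commutator of the components of parities `a` and `b` of two vector fields. -/
noncomputable def lie (a b : ZMod 2) (X Y : VectorField M U) : VectorField M U where
  -- With the parts inserted this is a derivation for arbitrary `X`, `Y`, hence additive in each of
  -- them; the plain operator `bracket a b X Y` is one only for fields of the stated parities.
  toFun V hV := bracket a b (part a X) (part b Y) V hV
  res_toFun V V' hV h f := by simp [bracket, VectorField.res_toFun]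
  leibniz V hV c f g hf := by
    have hX := isHomogeneous_part a X
    have hY := isHomogeneous_part b Y
    generalize part a X = X at hX
    generalize part b Y = Y at hY
    -- For an operator of parity `a + b` the twists in the Leibniz rule amount to the sign `sgn ((a
    -- + b) * c)`.
    have e : ∀ F : M.Sec V →ₗ[ℝ] M.Sec V, (∀ d g, SuperRingedSpace.IsHomogeneous g d →
        SuperRingedSpace.IsHomogeneous (F g) (a + b + d)) →
        twist c V (F (twist c V g)) = sgn ((a + b) * c) • F g := by
      intro F hF
      rcases zmod_two c with rfl | rfl
      · simp [twist_zero]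
      · rw [twist_one, twist_one, mul_one]
        refine sec_induction (P := fun g => SuperRingedSpace.conj V
          (F (SuperRingedSpace.conj V g)) = sgn (a + b) • F g) ?_ ?_ g
        · intro d g hg
          have h1 : SuperRingedSpace.conj V g = sgn d • g := hg
          have h2 : SuperRingedSpace.conj V (F g) = sgn (a + b + d) • F g := hF d g hg
          rw [h1, map_smul, map_smul, h2, sgn_add, mul_comm, mul_smul, smul_sgn_smul]
        · intro f g hf hg
          rw [map_add, map_add, map_add, hf, hg, map_add, smul_add]
    have hF : ∀ d g, SuperRingedSpace.IsHomogeneous g d →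
        SuperRingedSpace.IsHomogeneous (bracket a b X Y V hV g) (a + b + d) := by
      intro d g hg
      have h1 := hX V hV _ _ (hY V hV _ _ hg)
      have h2 := hY V hV _ _ (hX V hV _ _ hg)
      rw [← add_assoc] at h1
      rw [← add_assoc, add_comm b] at h2
      simpa [bracket, sub_eq_add_neg] using h1.add (h2.smul (-sgn (a * b)))
    rw [e _ hF]
    have hYf := hY V hV _ _ hf
    have hXf := hX V hV _ _ hf
    simp only [bracket, LinearMap.sub_apply, LinearMap.smul_apply, LinearMap.comp_apply]
    rw [hY.toFun_mul hV hf, hX.toFun_mul hV hf]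
    simp only [map_add, map_smul]
    rw [hX.toFun_mul hV hYf, hX.toFun_mul hV hf, hY.toFun_mul hV hXf, hY.toFun_mul hV hf]
    simp only [sub_mul, mul_sub, smul_sub, smul_add, smul_mul_assoc, mul_smul_comm, smul_smul]
    -- In each of the eight parity cases the mixed terms, products of `X f` with `Y g` and of `Y f`
    -- with `X g`, cancel.
    rcases zmod_two a with rfl | rfl <;> rcases zmod_two b with rfl | rfl <;>
      rcases zmod_two c with rfl | rfl <;>
      simp [show (1 : ZMod 2) + 1 = 0 from rfl] <;> abel

theorem lie_toFun {X Y : VectorField M U} {a b : ZMod 2} (hX : X.IsHomogeneous a)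
    (hY : Y.IsHomogeneous b) (hV : V ≤ U) :
    (lie a b X Y).toFun V hV = bracket a b X Y V hV := by
  conv_rhs => rw [← hX.part_self, ← hY.part_self]
  rfl

theorem lie_toFun_apply {X Y : VectorField M U} {a b : ZMod 2} (hX : X.IsHomogeneous a)
    (hY : Y.IsHomogeneous b) (hV : V ≤ U) (f : M.Sec V) :
    (lie a b X Y).toFun V hV f = X.toFun V hV (Y.toFun V hV f) -
      sgn (a * b) • Y.toFun V hV (X.toFun V hV f) := by
  rw [lie_toFun hX hY]
  rfl

theorem isHomogeneous_lie {X Y : VectorField M U} {a b : ZMod 2} (hX : X.IsHomogeneous a)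
    (hY : Y.IsHomogeneous b) : (lie a b X Y).IsHomogeneous (a + b) := by
  intro V hV d g hg
  have h1 := hX V hV _ _ (hY V hV _ _ hg)
  have h2 := hY V hV _ _ (hX V hV _ _ hg)
  rw [← add_assoc] at h1
  rw [← add_assoc, add_comm b] at h2
  rw [lie_toFun_apply hX hY]
  simpa [sub_eq_add_neg] using h1.add (h2.smul (-sgn (a * b)))

theorem lie_add_left (a b : ZMod 2) (X X' Y : VectorField M U) :
    lie a b (X + X') Y = lie a b X Y + lie a b X' Y := by
  ext V hV f
  simp only [lie, bracket, part_add, add_toFun, LinearMap.sub_apply, LinearMap.smul_apply,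
    LinearMap.comp_apply, map_add, smul_add]
  abel

theorem lie_add_right (a b : ZMod 2) (X Y Y' : VectorField M U) :
    lie a b X (Y + Y') = lie a b X Y + lie a b X Y' := by
  ext V hV f
  simp only [lie, bracket, part_add, add_toFun, LinearMap.sub_apply, LinearMap.smul_apply,
    LinearMap.comp_apply, map_add, smul_add]
  abel

theorem lie_swap {X Y : VectorField M U} {a b : ZMod 2} (hX : X.IsHomogeneous a)
    (hY : Y.IsHomogeneous b) : lie b a Y X = -(sgn (a * b) • lie a b X Y) := by
  ext V hV f
  rw [lie_toFun_apply hY hX, neg_toFun, real_smul_toFun, lie_toFun_apply hX hY, smul_sub,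
    smul_sgn_smul, mul_comm b]
  abel

/-- The derivative term here and in `lie_smul_left` is what compensates the derivatives of `f` in
the Koszul expression. -/
theorem lie_smul_right {X Y : VectorField M U} {f : M.Sec U} {a b d : ZMod 2}
    (hX : X.IsHomogeneous a) (hY : Y.IsHomogeneous b)
    (hf : SuperRingedSpace.IsHomogeneous f d) :
    lie a (d + b) X (f • Y) = X.apply f • Y + sgn (a * d) • f • lie a b X Y := by
  ext V hV g
  rw [lie_toFun_apply hX (hY.smul hf)]
  simp only [add_toFun, smul_toFun, real_smul_toFun, lie_toFun_apply hX hY]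
  rw [hX.toFun_mul hV (hf.res hV), show X.apply f = X.toFun U le_rfl f from rfl, X.res_toFun, mul_sub, smul_sub, mul_smul_comm,
    smul_smul, mul_add, sgn_add]
  abel

theorem lie_smul_left {X Y : VectorField M U} {f : M.Sec U} {a b d : ZMod 2}
    (hX : X.IsHomogeneous a) (hY : Y.IsHomogeneous b)
    (hf : SuperRingedSpace.IsHomogeneous f d) :
    lie (d + a) b (f • X) Y = f • lie a b X Y - sgn ((d + a) * b) • Y.apply f • X := by
  rw [lie_swap hY (hX.smul hf), lie_smul_right hY hX hf, lie_swap hX hY]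
  simp only [smul_add, smul_neg, smul_comm f, smul_smul]
  have : sgn (b * (d + a)) * (sgn (b * d) * sgn (a * b)) = 1 := by
    rw [mul_add, mul_comm a b, ← sgn_add, sgn_mul_self]
  rw [this, mul_comm b (d + a), one_smul]
  abel

theorem restrict_lie (h : V ≤ U) (a b : ZMod 2) (X Y : VectorField M U) :
    (lie a b X Y).restrict h = lie a b (X.restrict h) (Y.restrict h) := by
  ext V' hV' f
  simp only [lie, ← restrict_part]
  rfl

end VectorField

/-- A smooth function on `W` agrees near each point of `W` with a smooth function on `ℝ^p`. -/
theorem SmoothFun.exists_contDiff_eventuallyEq {p : ℕ} {W : Opens (EuclideanSpace ℝ (Fin p))}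
    (r : SmoothFun W) (w : W) : ∃ F : EuclideanSpace ℝ (Fin p) → ℝ, ContDiff ℝ ∞ F ∧
      r.extend =ᶠ[nhds (w : EuclideanSpace ℝ (Fin p))] F := by
  obtain ⟨R, hR, hRW⟩ := Metric.nhds_basis_closedBall.mem_iff.1 (W.isOpen.mem_nhds w.2)
  -- The closed ball of radius `R` lies in `W`, so the product of the bump with the extension by
  -- zero is smooth everywhere, and it is unchanged near `w`.
  let χ : ContDiffBump (w : EuclideanSpace ℝ (Fin p)) := ⟨R / 2, R, by positivity, by linarith⟩
  refine ⟨fun x => χ x * r.extend x, contDiff_iff_contDiffAt.2 fun x => ?_, ?_⟩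
  · by_cases hx : x ∈ W
    · exact χ.contDiffAt.mul (r.contDiffAt_extend ⟨x, hx⟩)
    · have hx' : x ∉ tsupport χ := fun h => hx (hRW (by rwa [χ.tsupport_eq] at h))
      refine contDiffAt_const (c := (0 : ℝ)) |>.congr_of_eventuallyEq ?_
      filter_upwards [notMem_tsupport_iff_eventuallyEq.1 hx'] with y hy
      simp [hy]
  · filter_upwards [χ.eventuallyEq_one] with y hy
    simp [hy]

theorem SmoothFun.sum_apply {p : ℕ} {W : Opens (EuclideanSpace ℝ (Fin p))} {ι : Type*}
    (s : Finset ι) (f : ι → SmoothFun W) (w : W) : (∑ i ∈ s, f i) w = ∑ i ∈ s, f i w :=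
  map_sum (AddMonoidHom.mk' (fun f : SmoothFun W => f w) fun _ _ => rfl) f s

/-! ### Monomials and coordinate derivatives in the Grassmann algebra -/

namespace Grassmann

section Algebra

variable {R : Type*} [CommRing R] {q : ℕ}

/-- The monomial `r ξ^I`. -/
def monomial (I : Finset (Fin q)) (r : R) : Grassmann R q := fun J => if J = I then r else 0

theorem const_mul_apply (r : R) (a : Grassmann R q) (I : Finset (Fin q)) :
    ((const r : Grassmann R q) * a) I = r * a I := by
  rw [mul_apply, Finset.sum_eq_single ∅]
  · simp [const, inversions_empty_left]
  · intro J _ hJ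
    simp [const, hJ]
  · simp

theorem algebraMap_eq {S : Type*} [CommRing S] [Algebra S R] (s : S) :
    algebraMap S (Grassmann R q) s = const (algebraMap S R s) := by
  rw [Algebra.algebraMap_eq_smul_one]
  ext I
  by_cases h : I = ∅ <;> simp [one_apply, const, h, Algebra.algebraMap_eq_smul_one]

theorem conj_const (r : R) : conj (const r : Grassmann R q) = const r := by
  ext I
  by_cases h : I = ∅ <;> simp [conj, const, h]

theorem conj_gen (j : Fin q) : conj (gen j : Grassmann R q) = -gen j := by
  ext I
  change _ = -(_)
  by_cases h : I = {j} <;> simp [conj, gen, h]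

theorem conj_monomial (I : Finset (Fin q)) (r : R) :
    conj (monomial I r) = (-1 : R) ^ I.card • monomial I r := by
  ext J
  by_cases h : J = I <;> simp [conj, monomial, h]

/-- Builds monomials one odd generator at a time, as the induction in `eq_zero_of_apply_coordOn`
requires. Only the summand indexed by `{j}` survives in the product. -/
theorem gen_mul_monomial {j : Fin q} {I : Finset (Fin q)} (hj : j ∉ I) (r : R) :
    gen j * monomial I r = (-1 : R) ^ inversions {j} I • monomial (insert j I) r := by
  ext K
  rw [mul_apply, smul_apply, smul_eq_mul]
  by_cases hK : K = insert j I
  · subst hK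
    have h : insert j I \ {j} = I := by
      rw [Finset.insert_sdiff_of_mem _ (Finset.mem_singleton_self j), Finset.sdiff_singleton_eq_erase,
        Finset.erase_eq_of_notMem hj]
    rw [Finset.sum_eq_single {j}]
    · simp [gen, monomial, h]
    · intro J _ hJ
      simp [gen, hJ]
    · simp
  · rw [Finset.sum_eq_zero]
    · simp [monomial, hK]
    · intro J hJ
      by_cases hJj : J = {j}
      · subst hJj
        have : K \ {j} ≠ I := by
          rintro rfl
          apply hK
          rw [Finset.insert_eq, Finset.union_sdiff_of_subset (Finset.mem_powerset.1 hJ)]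
        simp [monomial, this]
      · simp [gen, hJj]

theorem sum_apply {ι : Type*} (s : Finset ι) (a : ι → Grassmann R q) (I : Finset (Fin q)) :
    (∑ i ∈ s, a i) I = ∑ i ∈ s, a i I := Finset.sum_apply I s a

theorem sum_monomial (a : Grassmann R q) : ∑ I, monomial I (a I) = a := by
  ext J
  exact (sum_apply _ _ _).trans ((Finset.sum_eq_single J (fun I _ hI => if_neg hI.symm)
    (by simp)).trans (if_pos rfl))

end Algebra

variable {p q : ℕ} {W : Opens (EuclideanSpace ℝ (Fin p))}

theorem pderiv_coord (i j : Fin p) :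
    SmoothFun.pderiv i (SmoothFun.coord j : SmoothFun W) = if i = j then 1 else 0 := by
  ext w
  have h : (SmoothFun.coord j : SmoothFun W).extend =ᶠ[nhds (w : EuclideanSpace ℝ (Fin p))]
      (EuclideanSpace.proj j : EuclideanSpace ℝ (Fin p) →L[ℝ] ℝ) :=
    SmoothFun.extend_eventuallyEq (fun _ => rfl) w
  rw [SmoothFun.pderiv_apply, h.fderiv_eq, ContinuousLinearMap.fderiv]
  split_ifs with hij
  · simp [hij]
  · simp [Ne.symm hij]

theorem stdPartial_stdCoord (i j : Fin p ⊕ Fin q) :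
    stdPartial i (stdCoord j : Grassmann (SmoothFun W) q) = if i = j then 1 else 0 := by
  rcases i with i | i <;> rcases j with j | j
  · change evenDeriv (SmoothFun.pderiv i) (const (SmoothFun.coord j)) = _
    ext1 I
    by_cases hij : i = j <;> by_cases hI : I = ∅ <;>
      simp [evenDeriv, const, hI, pderiv_coord, hij, one_apply]
  · change evenDeriv (SmoothFun.pderiv i) (gen j) = _
    ext1 I
    by_cases hI : I = {j} <;> simp [evenDeriv, gen, hI]
  · change oddDeriv i (const (SmoothFun.coord j)) = _
    ext1 I
    by_cases hI : i ∈ I <;> simp [oddDeriv, const, hI]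
  · change oddDeriv i (gen j) = _
    ext1 I
    by_cases hij : i = j
    · subst hij
      by_cases hI : I = ∅
      · subst hI
        simp [oddDeriv, gen, one_apply, inversions_empty_right]
      · by_cases hi : i ∈ I
        · simp [oddDeriv, hi, one_apply, hI]
        · have : insert i I ≠ {i} := by
            intro h
            apply hI
            rw [← Finset.erase_insert hi, h, Finset.erase_singleton]
          simp [oddDeriv, hi, one_apply, hI, gen, this]
    · have h : insert i I ≠ {j} := fun h => hij (by
        rw [← Finset.mem_singleton, ← h]; exact Finset.mem_insert_self _ _)
      simp [oddDeriv, gen, h, hij]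

theorem conj_stdCoord (i : Fin p ⊕ Fin q) :
    conj (stdCoord i : Grassmann (SmoothFun W) q) = sgn (parity i) • stdCoord i := by
  rcases i with i | i
  · simp [stdCoord, parity, conj_const]
  · simp [stdCoord, parity, conj_gen]

theorem stdPartial_conj (i : Fin p ⊕ Fin q) (a : Grassmann (SmoothFun W) q) :
    conj (stdPartial i (conj a)) = sgn (parity i) • stdPartial i a := by
  rcases i with i | i
  · change conj (evenDeriv _ (conj a)) = sgn 0 • evenDeriv _ a
    simp [evenDeriv_conj, conj_conj]
  · change conj (oddDeriv _ (conj a)) = sgn 1 • oddDeriv _ a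
    rw [oddDeriv_conj, sgn_one, neg_smul, one_smul]
    ext1 I
    change _ * -(_ * _) = -(_)
    have : ((-1 : SmoothFun W) ^ I.card) * (-1) ^ I.card = 1 := by
      rw [← mul_pow]; simp
    linear_combination (-(oddDeriv i a I)) * this

end Grassmann

/-! ### Vector fields in a chart -/

namespace SuperRingedSpace.Chart

variable {M : SuperRingedSpace.{u}} {p q : ℕ} (χ : M.Chart p q) {V V' : Opens M.carrier}

theorem isHomogeneous_iff_iso (hV : V ≤ χ.source) (f : M.Sec V) (a : ZMod 2) :
    IsHomogeneous f a ↔ Grassmann.conj (χ.iso V hV f) = sgn a • χ.iso V hV f := by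
  rw [← χ.iso_conj, ← map_smul, (χ.iso V hV).injective.eq_iff]
  rfl

/-- The coordinates on an open subset of the domain of the chart. -/
noncomputable def coordOn (hV : V ≤ χ.source) (i : Fin p ⊕ Fin q) : M.Sec V := res hV (χ.coord i)

/-- The coordinate vector fields on an open subset of the domain of the chart. -/
noncomputable def frame (hV : V ≤ χ.source) (i : Fin p ⊕ Fin q) : VectorField M V :=
  (χ.coordField i).restrict hV

theorem res_coordOn (hV : V ≤ χ.source) (h : V' ≤ V) (i : Fin p ⊕ Fin q) :
    res h (χ.coordOn hV i) = χ.coordOn (h.trans hV) i := res_res _ _ _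

theorem restrict_frame (hV : V ≤ χ.source) (h : V' ≤ V) (i : Fin p ⊕ Fin q) :
    (χ.frame hV i).restrict h = χ.frame (h.trans hV) i := rfl

theorem iso_coordOn (hV : V ≤ χ.source) (i : Fin p ⊕ Fin q) :
    χ.iso V hV (χ.coordOn hV i) = Grassmann.stdCoord i := by
  ext I w
  rw [coordOn, χ.iso_res χ.source V le_rfl hV, coord, AlgEquiv.apply_symm_apply]
  rcases i with i | i
  · by_cases hI : I = ∅
    · simp only [Grassmann.stdCoord, Sum.elim_inl, Grassmann.const, hI, if_true]
      rfl
    · simp [Grassmann.stdCoord, Grassmann.const, hI]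
  · by_cases hI : I = {i} <;> simp [Grassmann.stdCoord, Grassmann.gen, hI]

theorem isHomogeneous_coordOn (hV : V ≤ χ.source) (i : Fin p ⊕ Fin q) :
    IsHomogeneous (χ.coordOn hV i) (parity i) := by
  rw [χ.isHomogeneous_iff_iso hV, iso_coordOn, Grassmann.conj_stdCoord]

theorem isHomogeneous_frame (hV : V ≤ χ.source) (i : Fin p ⊕ Fin q) :
    (χ.frame hV i).IsHomogeneous (parity i) := by
  refine VectorField.IsHomogeneous.restrict (VectorField.isHomogeneous_iff.2 ?_) hV
  ext V' hV' f
  apply (χ.iso V' hV').injective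
  simp [VectorField.conj_toFun, coordField, χ.iso_conj, Grassmann.stdPartial_conj]

theorem frame_apply_coordOn (hV : V ≤ χ.source) (i j : Fin p ⊕ Fin q) :
    (χ.frame hV i).apply (χ.coordOn hV j) = if i = j then 1 else 0 := by
  apply (χ.iso V hV).injective
  change χ.iso V hV ((χ.iso V hV).symm (Grassmann.stdPartial i (χ.iso V hV _))) = _
  rw [AlgEquiv.apply_symm_apply, iso_coordOn, Grassmann.stdPartial_stdCoord]
  split_ifs <;> simp

/-- A vector field which annihilates the coordinates annihilates the smooth functions of the
even coordinates. -/
theorem toFun_const_eq_zero (hV : V ≤ χ.source) {Z : VectorField M V}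
    (hZ : ∀ i, Z.apply (χ.coordOn hV i) = 0) (h : V' ≤ V)
    (r : SmoothFun (chartImage χ.homeo V')) :
    Z.toFun V' h ((χ.iso V' (h.trans hV)).symm (Grassmann.const r)) = 0 := by
  apply (χ.iso V' (h.trans hV)).injective
  ext I w
  rw [map_zero]
  -- It is enough to see that all coefficients of `Z f` vanish at an arbitrary point `w`. Near `w`,
  -- `r` may be replaced by a function on all of `ℝ^p`, to which Hadamard's lemma applies.
  obtain ⟨F, hF, hrF⟩ := r.exists_contDiff_eventuallyEq w
  obtain ⟨b, hb, hFb⟩ := exists_contDiff_eq_add_sum hF w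
  obtain ⟨O, hO, hOo, hwO⟩ := mem_nhds_iff.1
    (Filter.inter_mem hrF ((chartImage χ.homeo V').isOpen.mem_nhds w.2))
  have hOi : O ⊆ chartImage χ.homeo V' := fun x hx => (hO hx).2
  -- The part of the chart domain lying over the neighbourhood `O` of `w` on which `r` equals `F`.
  let V'' : Opens M.carrier :=
    ⟨χ.homeo.source ∩ χ.homeo ⁻¹' O, χ.homeo.isOpen_inter_preimage hOo⟩
  have h'' : V'' ≤ V' := by
    rintro x ⟨hx, hxO⟩
    have := (hOi hxO).2
    change χ.homeo.symm (χ.homeo x) ∈ V' at this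
    rwa [χ.homeo.left_inv hx] at this
  have hwV : (w : EuclideanSpace ℝ (Fin p)) ∈ chartImage χ.homeo V'' := by
    refine ⟨w.2.1, χ.homeo.map_target w.2.1, ?_⟩
    change χ.homeo (χ.homeo.symm w) ∈ O
    rwa [χ.homeo.right_inv w.2.1]
  have hVO : ∀ x ∈ chartImage χ.homeo V'', x ∈ O := by
    rintro x ⟨hx, -, hxO⟩
    change χ.homeo (χ.homeo.symm x) ∈ O at hxO
    rwa [χ.homeo.right_inv hx] at hxO
  have hs : V'' ≤ χ.source := h''.trans (h.trans hV)
  let B : Fin p → SmoothFun (chartImage χ.homeo V'') := fun j =>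
    ⟨fun x => b j x, SmoothFun.contMDiff_of_contDiffAt _ fun x => (hb j).contDiffAt⟩
  set f := (χ.iso V' (h.trans hV)).symm (Grassmann.const r) with hf
  let x' : Fin p → M.Sec V'' := fun j =>
    χ.coordOn hs (Sum.inl j) - algebraMap ℝ _ ((w : EuclideanSpace ℝ (Fin p)) j)
  have hx' : ∀ j, χ.iso V'' hs (x' j) =
      Grassmann.const (SmoothFun.coord j - algebraMap ℝ _ ((w : EuclideanSpace ℝ (Fin p)) j)) := by
    intro j
    simp only [x', map_sub, iso_coordOn, AlgEquiv.commutes, Grassmann.algebraMap_eq]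
    ext1 J
    change (Grassmann.const (SmoothFun.coord j) : Grassmann _ q) J - _ = _
    by_cases hJ : J = ∅ <;> simp [Grassmann.const, hJ]
  have hfeq : res h'' f = algebraMap ℝ _ (F w) +
      ∑ j, x' j * (χ.iso V'' hs).symm (Grassmann.const (B j)) := by
    apply (χ.iso V'' hs).injective
    ext J x
    rw [χ.iso_res V' V'' (h.trans hV) h'', hf, AlgEquiv.apply_symm_apply]
    simp only [map_add, map_sum, map_mul, AlgEquiv.commutes, AlgEquiv.apply_symm_apply, hx',
      Grassmann.algebraMap_eq, Grassmann.add_apply, Grassmann.sum_apply, Grassmann.const_mul_apply]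
    by_cases hJ : J = ∅
    · simp only [Grassmann.const, hJ, if_true]
      have e1 : r ⟨x, chartImage_mono χ.homeo h'' x.2⟩ = F x := by
        rw [← SmoothFun.extend_coe]
        exact (hO (hVO x x.2)).1
      rw [e1, hFb x, ContMDiffMap.coe_add, Pi.add_apply]
      congr 1
      rw [SmoothFun.sum_apply]
      refine Finset.sum_congr rfl fun j _ => ?_
      rfl
    · simp [Grassmann.const, hJ]
  have hZx : ∀ j, Z.toFun V'' (h''.trans h) (x' j) = 0 := by
    intro j
    rw [map_sub, VectorField.toFun_algebraMap, sub_zero, ← χ.res_coordOn hV (h''.trans h), ← Z.res_toFun V V'' le_rfl]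
    exact (congrArg _ (hZ (Sum.inl j))).trans (map_zero _)
  have hx'0 : ∀ j, IsHomogeneous (x' j) 0 := by
    intro j
    rw [χ.isHomogeneous_iff_iso hs, hx', Grassmann.conj_const, sgn_zero, one_smul]
  -- `Z` kills constants and the `x^j - w_j`. What remains is `∑ (x^j - w_j) Z(B_j)`, and the first
  -- factors vanish at `w`.
  have key : χ.iso V'' hs (Z.toFun V'' (h''.trans h) (res h'' f)) I ⟨w, hwV⟩ = 0 := by
    rw [hfeq, map_add, VectorField.toFun_algebraMap, zero_add, map_sum]
    simp only [Z.leibniz_of_even _ (hx'0 _), hZx, zero_mul, zero_add, map_sum, map_mul, hx',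
      Grassmann.sum_apply, SmoothFun.sum_apply, Grassmann.const_mul_apply]
    refine Finset.sum_eq_zero fun j _ => ?_
    change (((w : EuclideanSpace ℝ (Fin p)) j - (w : EuclideanSpace ℝ (Fin p)) j) * _ : ℝ) = 0
    rw [sub_self, zero_mul]
  rw [← Z.res_toFun V' V'' h h'', χ.iso_res V' V'' (h.trans hV) h''] at key
  exact key

/-- A vector field which annihilates the coordinates vanishes. -/
theorem eq_zero_of_apply_coordOn (hV : V ≤ χ.source) {Z : VectorField M V}
    (hZ : ∀ i, Z.apply (χ.coordOn hV i) = 0) : Z = 0 := by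
  ext V' h f
  have hs : V' ≤ χ.source := h.trans hV
  have hm : ∀ (I : Finset (Fin q)) (r : SmoothFun (chartImage χ.homeo V')),
      Z.toFun V' h ((χ.iso V' hs).symm (Grassmann.monomial I r)) = 0 := by
    intro I
    induction I using Finset.induction_on with
    | empty => exact fun r => χ.toFun_const_eq_zero hV hZ h r
    | insert j I hj ih =>
      intro r
      -- Each sign is its own inverse. The outer one is a real scalar, so `Z` commutes with it; the
      -- inner one turns the monomial into `ξ_j ξ^I`.
      have e : ∀ n : ℕ, ∀ a : Grassmann (SmoothFun (chartImage χ.homeo V')) q,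
          a = (-1 : ℝ) ^ n • (-1 : SmoothFun (chartImage χ.homeo V')) ^ n • a := by
        intro n a
        rcases Nat.even_or_odd n with h | h <;> simp [h.neg_one_pow]
      have hgen : Z.toFun V' h (χ.coordOn hs (Sum.inr j)) = 0 := by
        rw [← χ.res_coordOn hV h, ← Z.res_toFun V V' le_rfl]
        exact (congrArg _ (hZ (Sum.inr j))).trans (map_zero _)
      have hg1 := χ.isHomogeneous_coordOn hs (Sum.inr j)
      have hgI : (χ.iso V' hs).symm (Grassmann.gen j) = χ.coordOn hs (Sum.inr j) := by
        rw [AlgEquiv.symm_apply_eq, iso_coordOn]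
        rfl
      -- The Leibniz rule past the odd `ξ_j` conjugates the monomial. This changes only its
      -- coefficient, which is why the induction hypothesis ranges over all `r`.
      have hconj : conj V' ((χ.iso V' hs).symm (Grassmann.monomial I r)) =
          (χ.iso V' hs).symm (Grassmann.monomial I ((-1) ^ I.card * r)) := by
        apply (χ.iso V' hs).injective
        rw [χ.iso_conj, AlgEquiv.apply_symm_apply, AlgEquiv.apply_symm_apply,
          Grassmann.conj_monomial]
        ext1 J
        by_cases hJ : J = I <;> simp [Grassmann.monomial, hJ]
      rw [e (inversions {j} I) (Grassmann.monomial (insert j I) r), ← Grassmann.gen_mul_monomial hj,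
        map_smul, map_smul, map_mul, hgI, Z.leibniz V' h _ _ _ hg1, hgen]
      simp only [parity, Sum.elim_inr, twist_one, hconj, ih, map_zero, mul_zero, zero_mul, add_zero,
        smul_zero]
  rw [← (χ.iso V' hs).symm_apply_apply f, ← Grassmann.sum_monomial (χ.iso V' hs f), map_sum, map_sum]
  exact Finset.sum_eq_zero fun I _ => hm I _

/-- A vector field is determined by its components `X(x^i)`. -/
theorem eq_of_apply_coordOn (hV : V ≤ χ.source) {X Y : VectorField M V}
    (h : ∀ i, X.apply (χ.coordOn hV i) = Y.apply (χ.coordOn hV i)) : X = Y := by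
  refine sub_eq_zero.1 (χ.eq_zero_of_apply_coordOn hV fun i => ?_)
  exact (VectorField.sub_toFun X Y V le_rfl _).trans (sub_eq_zero.2 (h i))

/-- `X = ∑ X(x^i) ∂/∂x^i`. -/
theorem sum_apply_smul_frame (hV : V ≤ χ.source) (X : VectorField M V) :
    ∑ i, X.apply (χ.coordOn hV i) • χ.frame hV i = X := by
  refine χ.eq_of_apply_coordOn hV fun j => ?_
  simp only [VectorField.sum_apply, VectorField.smul_apply, frame_apply_coordOn, mul_ite, mul_one,
    mul_zero, Finset.sum_ite_eq', Finset.mem_univ, if_true]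

/-- The frame sends every coordinate to `0` or `1`, which every vector field kills; so the bracket
annihilates the coordinates. -/
theorem lie_frame (hV : V ≤ χ.source) (i j : Fin p ⊕ Fin q) :
    VectorField.lie (parity i) (parity j) (χ.frame hV i) (χ.frame hV j) = 0 := by
  refine χ.eq_zero_of_apply_coordOn hV fun k => ?_
  have h0 : ∀ (X : VectorField M V) (P : Prop) [Decidable P],
      X.toFun V le_rfl (if P then 1 else 0) = 0 := by
    intro X P _
    split_ifs
    · exact X.toFun_one le_rfl
    · exact map_zero _
  have h1 : ∀ i, (χ.frame hV i).toFun V le_rfl (χ.coordOn hV k) = if i = k then 1 else 0 :=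
    fun i => χ.frame_apply_coordOn hV i k
  rw [VectorField.apply, VectorField.lie_toFun_apply (χ.isHomogeneous_frame hV i)
    (χ.isHomogeneous_frame hV j), h1, h1, h0, h0, smul_zero, sub_zero]

end SuperRingedSpace.Chart

/-! ### Gluing superfunctions and vector fields -/

namespace SuperRingedSpace

variable {M : SuperRingedSpace.{u}} {U V : Opens M.carrier}

theorem exists_res_eq {ι : Type*} (U : ι → Opens M.carrier) (hU : ∀ i, U i ≤ V)
    (hcover : V ≤ iSup U) (s : ∀ i, M.Sec (U i))
    (h : ∀ i j, res (inf_le_left : U i ⊓ U j ≤ U i) (s i) =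
      res (inf_le_right : U i ⊓ U j ≤ U j) (s j)) :
    ∃ t : M.Sec V, ∀ i, res (hU i) t = s i :=
  (TopCat.Sheaf.existsUnique_gluing' M.toSheafedSpace.sheaf U V (fun i => homOfLE (hU i)) hcover s
    h).exists

theorem eq_of_res_eq {ι : Type*} (U : ι → Opens M.carrier) (hU : ∀ i, U i ≤ V)
    (hcover : V ≤ iSup U) {s t : M.Sec V} (h : ∀ i, res (hU i) s = res (hU i) t) : s = t :=
  TopCat.Sheaf.eq_of_locally_eq' M.toSheafedSpace.sheaf U V (fun i => homOfLE (hU i)) hcover s t h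

theorem eq_of_locally_eq {s t : M.Sec V}
    (h : ∀ m ∈ V, ∃ (W : Opens M.carrier) (hW : W ≤ V), m ∈ W ∧ res hW s = res hW t) : s = t := by
  choose W hW hm e using h
  refine eq_of_res_eq (fun m : V => W m m.2) (fun m => hW m m.2) ?_ fun m => e m m.2
  exact fun m hm' => Opens.mem_iSup.2 ⟨⟨m, hm'⟩, hm m hm'⟩

end SuperRingedSpace

namespace VectorField

open SuperRingedSpace

variable {M : SuperRingedSpace.{u}} {U V : Opens M.carrier}

theorem eq_of_locally_eq {X Y : VectorField M U}
    (h : ∀ m ∈ U, ∃ (W : Opens M.carrier) (hW : W ≤ U), m ∈ W ∧ X.restrict hW = Y.restrict hW) :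
    X = Y := by
  ext V hV f
  refine SuperRingedSpace.eq_of_locally_eq fun m hm => ?_
  obtain ⟨W, hW, hmW, e⟩ := h m (hV hm)
  refine ⟨V ⊓ W, inf_le_left, ⟨hm, hmW⟩, ?_⟩
  rw [X.res_toFun, Y.res_toFun]
  exact congrArg (fun Z : VectorField M W => Z.toFun (V ⊓ W) inf_le_right (res inf_le_left f)) e

/-- Vector fields can be glued. -/
theorem exists_restrict_eq {ι : Type*} (W : ι → Opens M.carrier) (hW : ∀ i, W i ≤ U)
    (hcover : U ≤ iSup W) (X : ∀ i, VectorField M (W i))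
    (h : ∀ i j, (X i).restrict (inf_le_left : W i ⊓ W j ≤ W i) =
      (X j).restrict (inf_le_right : W i ⊓ W j ≤ W j)) :
    ∃ Y : VectorField M U, ∀ i, Y.restrict (hW i) = X i := by
  have hc : ∀ V : Opens M.carrier, V ≤ U → V ≤ ⨆ i, V ⊓ W i := fun V hV m hm => by
    obtain ⟨i, hi⟩ := Opens.mem_iSup.1 (hcover (hV hm))
    exact Opens.mem_iSup.2 ⟨i, hm, hi⟩
  have hX : ∀ i j (V : Opens M.carrier) (hi : V ≤ W i) (hj : V ≤ W j) (f : M.Sec V),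
      (X i).toFun V hi f = (X j).toFun V hj f := fun i j V hi hj f =>
    congrArg (fun Z : VectorField M (W i ⊓ W j) => Z.toFun V (le_inf hi hj) f) (h i j)
  -- The value on `f` is glued from the `X_i (f|_(V ∩ W_i))`. Linearity, compatibility with
  -- restriction and the Leibniz rule then hold because they hold on each piece.
  have hex : ∀ (V : Opens M.carrier) (hV : V ≤ U) (f : M.Sec V), ∃ t : M.Sec V,
      ∀ i, res (inf_le_left : V ⊓ W i ≤ V) t =
        (X i).toFun (V ⊓ W i) inf_le_right (res inf_le_left f) := by
    intro V hV f
    refine exists_res_eq _ (fun i => inf_le_left) (hc V hV) _ fun i j => ?_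
    rw [(X i).res_toFun, (X j).res_toFun, res_res, res_res]
    exact hX i j _ _ _ _
  choose F hF using hex
  have huniq : ∀ (V : Opens M.carrier) (_ : V ≤ U) (s t : M.Sec V),
      (∀ i, res (inf_le_left : V ⊓ W i ≤ V) s = res inf_le_left t) → s = t := fun V hV s t e =>
    eq_of_res_eq _ (fun i => inf_le_left) (hc V hV) e
  refine ⟨{ toFun := fun V hV => { toFun := F V hV, map_add' := ?_, map_smul' := ?_ }
            res_toFun := ?_
            leibniz := ?_ }, fun i => ?_⟩
  · intro f g
    refine huniq V hV _ _ fun i => ?_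
    simp only [map_add, hF]
  · intro r f
    refine huniq V hV _ _ fun i => ?_
    simp only [map_smul, hF, RingHom.id_apply]
  · intro V V' hV h' f
    refine huniq V' (h'.trans hV) _ _ fun i => ?_
    have e : V' ⊓ W i ≤ V ⊓ W i := inf_le_inf_right _ h'
    have := congrArg (res e) (hF V hV f i)
    rw [res_res, (X i).res_toFun, res_res] at this
    simp only [LinearMap.coe_mk, AddHom.coe_mk]
    rw [hF, res_res, res_res]
    exact this
  · intro V hV b f g hf
    refine huniq V hV _ _ fun i => ?_
    have ht : ∀ (h : V ⊓ W i ≤ V) (k : M.Sec V), res h (twist b V k) = twist b _ (res h k) := by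
      intro h k
      rcases zmod_two b with rfl | rfl
      · rfl
      · exact res_conj h k
    simp only [LinearMap.coe_mk, AddHom.coe_mk, map_mul, map_add, hF, ht]
    exact (X i).leibniz _ _ b _ _ (hf.res _)
  · ext V hV f
    change F V (hV.trans (hW i)) f = _
    have e : V ≤ V ⊓ W i := le_inf le_rfl hV
    have := congrArg (res e) (hF V (hV.trans (hW i)) f i)
    rw [res_res, (X i).res_toFun, res_res] at this
    rwa [res_self, res_self] at this

end VectorField

/-! ### Bump functions and the locality of connections -/

namespace Supermanifold

open SuperRingedSpace

variable {p q : ℕ} {M : Supermanifold.{u} p q}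

/-- Bump functions: an even superfunction equal to `1` near a point, which vanishes outside of a
closed subset of a given neighbourhood. -/
theorem exists_bump {U : Opens M.carrier} {m : M.carrier} (hm : m ∈ U) :
    ∃ (ρ : M.Sec ⊤) (V K : Opens M.carrier), IsHomogeneous ρ 0 ∧ m ∈ V ∧ V ≤ U ∧ U ⊔ K = ⊤ ∧
      res le_top ρ = (1 : M.Sec V) ∧ res le_top ρ = (0 : M.Sec K) := by
  obtain ⟨χ, hχ⟩ := M.exists_chart m
  have := M.t2Space
  let O := chartImage χ.homeo (U ⊓ χ.source)
  have hmO : χ.homeo m ∈ O := ⟨χ.homeo.map_source hχ, by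
    change χ.homeo.symm (χ.homeo m) ∈ U ⊓ χ.source
    rw [χ.homeo.left_inv hχ]
    exact ⟨hm, hχ⟩⟩
  obtain ⟨R, hR, hRO⟩ := Metric.nhds_basis_closedBall.mem_iff.1 (O.isOpen.mem_nhds hmO)
  let β : ContDiffBump (χ.homeo m) := ⟨R / 2, R, by positivity, by linarith⟩
  have hRt : Metric.closedBall (χ.homeo m) R ⊆ χ.homeo.target := fun x hx => (hRO hx).1
  have hC : IsCompact (χ.homeo.symm '' Metric.closedBall (χ.homeo m) R) :=
    (isCompact_closedBall _ _).image_of_continuousOn (χ.homeo.continuousOn_symm.mono hRt)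
  -- The Hausdorff property enters here: the part of `M` over the closed ball is compact, hence
  -- closed in all of `M`, and its complement is open.
  let K : Opens M.carrier := ⟨_, hC.isClosed.isOpen_compl⟩
  let V : Opens M.carrier := ⟨χ.homeo.source ∩ χ.homeo ⁻¹' Metric.ball (χ.homeo m) (R / 2),
    χ.homeo.isOpen_inter_preimage Metric.isOpen_ball⟩
  have hUK : U ⊔ K = ⊤ := by
    refine top_le_iff.1 fun x _ => ?_
    by_cases hx : x ∈ χ.homeo.symm '' Metric.closedBall (χ.homeo m) R
    · obtain ⟨y, hy, rfl⟩ := hx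
      exact Or.inl (hRO hy).2.1
    · exact Or.inr hx
  have hsK : χ.source ⊔ K = ⊤ := by
    refine top_le_iff.1 fun x _ => ?_
    by_cases hx : x ∈ χ.homeo.symm '' Metric.closedBall (χ.homeo m) R
    · obtain ⟨y, hy, rfl⟩ := hx
      exact Or.inl (hRO hy).2.2
    · exact Or.inr hx
  let r : SmoothFun (chartImage χ.homeo χ.source) :=
    ⟨fun x => β x, SmoothFun.contMDiff_of_contDiffAt _ fun x => β.contDiffAt⟩
  let f : M.Sec χ.source := (χ.iso χ.source le_rfl).symm (Grassmann.const r)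
  have hf0 : IsHomogeneous f 0 := by
    rw [χ.isHomogeneous_iff_iso le_rfl, AlgEquiv.apply_symm_apply, Grassmann.conj_const, sgn_zero,
      one_smul]
  have hfr : ∀ (W : Opens M.carrier) (h : W ≤ χ.source) (I : Finset (Fin q))
      (x : chartImage χ.homeo W), χ.iso W h (res h f) I x = if I = ∅ then β x else 0 := by
    intro W h I x
    rw [χ.iso_res _ _ le_rfl h, AlgEquiv.apply_symm_apply]
    by_cases hI : I = ∅
    · simp only [Grassmann.const, hI, if_true]
      rfl
    · simp [Grassmann.const, hI]
  have hVs : V ≤ χ.source := fun x hx => hx.1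
  have hf1 : res hVs f = 1 := by
    apply (χ.iso V hVs).injective
    ext I x
    rw [hfr, map_one, Grassmann.one_apply]
    by_cases hI : I = ∅
    · have hx : (x : EuclideanSpace ℝ (Fin p)) ∈ Metric.ball (χ.homeo m) (R / 2) := by
        have := x.2.2.2
        change χ.homeo (χ.homeo.symm x) ∈ Metric.ball (χ.homeo m) (R / 2) at this
        rwa [χ.homeo.right_inv x.2.1] at this
      rw [if_pos hI, if_pos hI, β.one_of_mem_closedBall (Metric.ball_subset_closedBall hx)]
      rfl
    · rw [if_neg hI, if_neg hI]
      rfl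
  have hfK : res (inf_le_left : χ.source ⊓ K ≤ χ.source) f = 0 := by
    apply (χ.iso _ inf_le_left).injective
    ext I x
    rw [hfr, map_zero]
    by_cases hI : I = ∅
    · have hx : (x : EuclideanSpace ℝ (Fin p)) ∉ Metric.closedBall (χ.homeo m) R := fun h =>
        x.2.2.2 ⟨x, h, rfl⟩
      rw [if_pos hI, β.zero_of_le_dist (not_le.1 hx).le]
      rfl
    · rw [if_neg hI]
      rfl
  have hfK' : res (inf_le_right : K ⊓ χ.source ≤ χ.source) f = 0 := by
    have := congrArg (res (le_inf inf_le_right inf_le_left : K ⊓ χ.source ≤ χ.source ⊓ K)) hfK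
    rwa [res_res, map_zero] at this
  -- The global bump is glued from `f` on the chart domain and `0` on `K`; `f` vanishes on the
  -- overlap.
  let W : Bool → Opens M.carrier := fun b => Bool.rec K χ.source b
  have hcov : ⊤ ≤ iSup W := by
    rw [← hsK]
    exact sup_le (le_iSup W true) (le_iSup W false)
  let s : ∀ b, M.Sec (W b) := fun b => Bool.rec (0 : M.Sec K) f b
  obtain ⟨ρ, hρ⟩ := exists_res_eq W (fun _ => le_top) hcov s (by
    rintro (_ | _) (_ | _)
    · rfl
    · exact (map_zero _).trans hfK'.symm
    · exact hfK.trans (map_zero _).symm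
    · rfl)
  have hρf : res le_top ρ = f := hρ true
  have hρK : res le_top ρ = (0 : M.Sec K) := hρ false
  refine ⟨ρ, V, K, ?_, ⟨hχ, Metric.mem_ball_self (by positivity)⟩, ?_, hUK, ?_, hρK⟩
  · refine eq_of_res_eq W (fun _ => le_top) hcov ?_
    rw [sgn_zero, one_smul]
    rintro (_ | _)
    · refine (res_conj _ _).trans ?_
      change conj K (res le_top ρ) = res le_top ρ
      rw [hρK, map_zero]
    · refine (res_conj _ _).trans ?_
      change conj χ.source (res le_top ρ) = res le_top ρ
      rw [hρf]
      exact hf0.trans (by rw [sgn_zero, one_smul])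
  · rintro x ⟨hx, hx'⟩
    have := (hRO (Metric.ball_subset_closedBall
      (Metric.ball_subset_ball (by linarith : R / 2 ≤ R) hx'))).2.1
    rwa [χ.homeo.left_inv hx] at this
  · rw [← hf1, ← hρf, res_res]

theorem eq_of_restrict_sup {U V K : Opens M.carrier} (hV : V ≤ U) (h : V ⊔ K = ⊤) {X Y : M.VF U}
    (h1 : X.restrict hV = Y.restrict hV)
    (h2 : X.restrict (inf_le_left : U ⊓ K ≤ U) = Y.restrict inf_le_left) : X = Y := by
  refine VectorField.eq_of_locally_eq fun m hm => ?_
  have hm' : m ∈ V ⊔ K := h ▸ Opens.mem_top m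
  rcases hm' with hmV | hmK
  · exact ⟨V, hV, hmV, h1⟩
  · exact ⟨U ⊓ K, inf_le_left, ⟨hm, hmK⟩, h2⟩

/-- Every vector field on an open set agrees near a given point with a global one. -/
theorem exists_global_eq {U : Opens M.carrier} (X : M.VF U) {m : M.carrier} (hm : m ∈ U) :
    ∃ (Y : M.VF ⊤) (V : Opens M.carrier) (hV : V ≤ U), m ∈ V ∧
      Y.restrict le_top = X.restrict hV := by
  obtain ⟨ρ, V, K, -, hmV, hVU, hUK, hρV, hρK⟩ := exists_bump hm
  let W : Bool → Opens M.carrier := fun b => Bool.rec K U b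
  have hcov : ⊤ ≤ iSup W := by
    rw [← hUK]
    exact sup_le (le_iSup W true) (le_iSup W false)
  -- The global field is `ρ X` on `U` and `0` on `K`; it equals `X` where `ρ = 1`.
  let s : ∀ b, M.VF (W b) := fun b => Bool.rec (0 : M.VF K) (res (le_top : U ≤ ⊤) ρ • X : M.VF U) b
  have h0 : ∀ (W : Opens M.carrier) (hU : W ≤ U) (_ : W ≤ K),
      (res (le_top : U ≤ ⊤) ρ • X : M.VF U).restrict hU = 0 := by
    intro W hU hK
    rw [VectorField.restrict_smul, res_res, ← res_res (le_top : K ≤ ⊤) hK, hρK, map_zero, zero_smul]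
  obtain ⟨Y, hY⟩ := VectorField.exists_restrict_eq W (fun _ => le_top) hcov s (by
    rintro (_ | _) (_ | _)
    · rfl
    · exact (h0 _ inf_le_right inf_le_left).symm
    · exact h0 _ inf_le_left inf_le_right
    · rfl)
  refine ⟨Y, V, hVU, hmV, ?_⟩
  have hYU : Y.restrict le_top = (res (le_top : U ≤ ⊤) ρ • X : M.VF U) := hY true
  rw [← VectorField.restrict_restrict le_top hVU, hYU, VectorField.restrict_smul, res_res, hρV,
    one_smul]

namespace Connection

variable {U : Opens M.carrier} (D : M.Connection U)

/-- The map `X ↦ ∇_X Y`. -/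
def leftHom (Y : M.VF U) : M.VF U →+ M.VF U := AddMonoidHom.mk' (fun X => D.toFun X Y) fun X X' =>
  D.add_left X X' Y

/-- The map `Y ↦ ∇_X Y`. -/
def rightHom (X : M.VF U) : M.VF U →+ M.VF U := AddMonoidHom.mk' (D.toFun X) (D.add_right X)

/-- For a bump `ρ` supported in `V` one has `ρ X = 0`, so `0 = ∇_(ρ X) Y = ρ ∇_X Y`, and `ρ = 1`
near `m`. -/
theorem local_left {X : M.VF U} (Y : M.VF U) {V : Opens M.carrier} (hV : V ≤ U)
    (h : X.restrict hV = 0) {m : M.carrier} (hm : m ∈ V) :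
    ∃ (W : Opens M.carrier) (hW : W ≤ U), m ∈ W ∧ (D.toFun X Y).restrict hW = 0 := by
  obtain ⟨ρ, W, K, -, hmW, hWV, hVK, hρW, hρK⟩ := exists_bump hm
  refine ⟨W, hWV.trans hV, hmW, ?_⟩
  have h0 : (res (le_top : U ≤ ⊤) ρ • X : M.VF U) = 0 := by
    refine eq_of_restrict_sup hV hVK ?_ ?_
    · rw [VectorField.restrict_smul, h, smul_zero]
      rfl
    · rw [VectorField.restrict_smul, res_res, ← res_res (le_top : K ≤ ⊤) inf_le_right, hρK,
        map_zero, zero_smul]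
      rfl
  have h1 := D.smul_left (res le_top ρ) X Y
  rw [h0, show D.toFun 0 Y = 0 from map_zero (D.leftHom Y)] at h1
  have h2 := congrArg (VectorField.restrict (hWV.trans hV)) h1
  rw [VectorField.restrict_smul, res_res, hρW, one_smul] at h2
  exact h2.symm

/-- As for `local_left`, with the extra Leibniz term `X(ρ) Y`, which vanishes where `ρ = 1`.
Evenness of `ρ` removes the sign. -/
theorem local_right (X : M.VF U) {Y : M.VF U} {V : Opens M.carrier} (hV : V ≤ U)
    (h : Y.restrict hV = 0) {m : M.carrier} (hm : m ∈ V) :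
    ∃ (W : Opens M.carrier) (hW : W ≤ U), m ∈ W ∧ (D.toFun X Y).restrict hW = 0 := by
  obtain ⟨ρ, W, K, hρ, hmW, hWV, hVK, hρW, hρK⟩ := exists_bump hm
  refine ⟨W, hWV.trans hV, hmW, ?_⟩
  have h0 : (res (le_top : U ≤ ⊤) ρ • Y : M.VF U) = 0 := by
    refine eq_of_restrict_sup hV hVK ?_ ?_
    · rw [VectorField.restrict_smul, h, smul_zero]
      rfl
    · rw [VectorField.restrict_smul, res_res, ← res_res (le_top : K ≤ ⊤) inf_le_right, hρK,
        map_zero, zero_smul]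
      rfl
  refine VectorField.homogeneous_induction
    (P := fun X => (D.toFun X Y).restrict (hWV.trans hV) = 0) ?_ ?_ X
  · intro a X hX
    have h1 := D.leibniz (res le_top ρ) X Y a 0 hX (hρ.res _)
    rw [h0, show D.toFun X 0 = 0 from map_zero (D.rightHom X)] at h1
    have h2 := congrArg (VectorField.restrict (hWV.trans hV)) h1
    rw [VectorField.restrict_add, VectorField.restrict_smul, VectorField.restrict_smul,
      VectorField.res_apply, map_smul, res_res, hρW, VectorField.apply_restrict,
      VectorField.toFun_one, zero_smul, zero_add, mul_zero, sgn_zero, one_smul, one_smul] at h2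
    exact h2.symm
  · intro X X' hX hX'
    rw [D.add_left, VectorField.restrict_add, hX, hX', add_zero]

/-- A connection is local in both arguments. -/
theorem locality {X X' Y Y' : M.VF U} {V : Opens M.carrier} (hV : V ≤ U)
    (hX : X.restrict hV = X'.restrict hV) (hY : Y.restrict hV = Y'.restrict hV) {m : M.carrier}
    (hm : m ∈ V) : ∃ (W : Opens M.carrier) (hW : W ≤ U), m ∈ W ∧
      (D.toFun X Y).restrict hW = (D.toFun X' Y').restrict hW := by
  obtain ⟨W, hW, hmW, e⟩ := D.local_left (X := X - X') Y hV
    ((VectorField.restrict_sub hV X X').trans (sub_eq_zero.2 hX)) hm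
  obtain ⟨W', hW', hmW', e'⟩ := D.local_right X' (Y := Y - Y') hV
    ((VectorField.restrict_sub hV Y Y').trans (sub_eq_zero.2 hY)) hm
  refine ⟨W ⊓ W', inf_le_left.trans hW, ⟨hmW, hmW'⟩, ?_⟩
  rw [show D.toFun (X - X') Y = D.toFun X Y - D.toFun X' Y from map_sub (D.leftHom Y) X X',
    VectorField.restrict_sub, sub_eq_zero] at e
  rw [show D.toFun X' (Y - Y') = D.toFun X' Y - D.toFun X' Y' from map_sub (D.rightHom X') Y Y',
    VectorField.restrict_sub, sub_eq_zero] at e'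
  exact (congrArg (VectorField.restrict inf_le_left) e).trans
    (congrArg (VectorField.restrict inf_le_right) e')

@[ext] theorem ext {D D' : M.Connection U} (h : ∀ X Y, D.toFun X Y = D'.toFun X Y) : D = D' := by
  cases D
  cases D'
  congr
  funext X Y
  exact h X Y

/-- The restriction of a connection to an open set is unique. -/
theorem IsRestriction.unique {D : M.Connection ⊤} {D₁ D₂ : M.Connection U}
    (h₁ : D.IsRestriction le_top D₁) (h₂ : D.IsRestriction le_top D₂) : D₁ = D₂ := by
  ext1 X Y
  refine VectorField.eq_of_locally_eq fun m hm => ?_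
  obtain ⟨X', V, hV, hmV, hX⟩ := exists_global_eq X hm
  obtain ⟨Y', V', hV', hmV', hY⟩ := exists_global_eq Y hm
  have hX' := congrArg (VectorField.restrict (inf_le_left : V ⊓ V' ≤ V)) hX
  have hY' := congrArg (VectorField.restrict (inf_le_right : V ⊓ V' ≤ V')) hY
  -- Replacing `X`, `Y` near `m` by global fields, locality expresses any restriction near `m`
  -- through `D` alone.
  have key : ∀ D₁ : M.Connection U, D.IsRestriction le_top D₁ →
      ∃ (W : Opens M.carrier) (hW : W ≤ U), m ∈ W ∧
        (D₁.toFun X Y).restrict hW = ((D.toFun X' Y').restrict le_top).restrict hW := by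
    intro D₁ h₁
    rw [← h₁ X' Y']
    exact D₁.locality (V := V ⊓ V') (inf_le_left.trans hV) hX'.symm hY'.symm ⟨hmV, hmV'⟩
  obtain ⟨W₁, hW₁, hm₁, e₁⟩ := key D₁ h₁
  obtain ⟨W₂, hW₂, hm₂, e₂⟩ := key D₂ h₂
  exact ⟨W₁ ⊓ W₂, inf_le_left.trans hW₁, ⟨hm₁, hm₂⟩,
    (congrArg (VectorField.restrict inf_le_left) e₁).trans
      (congrArg (VectorField.restrict inf_le_right) e₂).symm⟩

end Connection

end Supermanifold

/-! ### The metric in a frame, and the Koszul expression -/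

namespace Supermanifold.Metric

open SuperRingedSpace VectorField

variable {p q : ℕ} {M : Supermanifold.{u} p q} (g : M.Metric) {U V : Opens M.carrier}

/-- The map `X ↦ g(X, Y)`. -/
def leftHom (Y : M.VF U) : M.VF U →+ M.Sec U :=
  AddMonoidHom.mk' (fun X => g.toFun U X Y) fun X X' => g.add_left U X X' Y

/-- The map `Y ↦ g(X, Y)`. -/
def rightHom (X : M.VF U) : M.VF U →+ M.Sec U :=
  AddMonoidHom.mk' (g.toFun U X) (g.add_right U X)

theorem zero_left (Y : M.VF U) : g.toFun U 0 Y = 0 := map_zero (g.leftHom Y)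

theorem neg_right (X Y : M.VF U) : g.toFun U X (-Y) = -g.toFun U X Y := map_neg (g.rightHom X) Y

theorem sub_left (X X' Y : M.VF U) : g.toFun U (X - X') Y = g.toFun U X Y - g.toFun U X' Y :=
  map_sub (g.leftHom Y) X X'

theorem sub_right (X Y Y' : M.VF U) : g.toFun U X (Y - Y') = g.toFun U X Y - g.toFun U X Y' :=
  map_sub (g.rightHom X) Y Y'

theorem sum_left {ι : Type*} (s : Finset ι) (X : ι → M.VF U) (Y : M.VF U) :
    g.toFun U (∑ i ∈ s, X i) Y = ∑ i ∈ s, g.toFun U (X i) Y := map_sum (g.leftHom Y) X s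

theorem sum_right {ι : Type*} (s : Finset ι) (X : M.VF U) (Y : ι → M.VF U) :
    g.toFun U X (∑ i ∈ s, Y i) = ∑ i ∈ s, g.toFun U X (Y i) := map_sum (g.rightHom X) Y s

theorem real_smul_left (r : ℝ) (X Y : M.VF U) : g.toFun U (r • X) Y = r • g.toFun U X Y := by
  rw [real_smul_def, g.smul_left, Algebra.smul_def]

theorem real_smul_right (r : ℝ) (X Y : M.VF U) : g.toFun U X (r • Y) = r • g.toFun U X Y := by
  refine homogeneous_induction (P := fun X => g.toFun U X (r • Y) = r • g.toFun U X Y) ?_ ?_ X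
  · intro a X hX
    rw [real_smul_def, g.smul_right U _ X Y a 0 hX (isHomogeneous_algebraMap r), mul_zero, sgn_zero,
      one_smul, Algebra.smul_def]
  · intro X X' h h'
    rw [g.add_left, g.add_left, h, h', smul_add]

/-- Evenness of `g` in a form free of homogeneity assumptions, used to read off the parity of a
field from its inner products. -/
theorem conj_toFun (X Y : M.VF U) :
    SuperRingedSpace.conj U (g.toFun U X Y) = g.toFun U X.conj Y.conj := by
  refine homogeneous_induction (P := fun X => SuperRingedSpace.conj U (g.toFun U X Y) =
    g.toFun U X.conj Y.conj) ?_ ?_ X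
  · intro a X hX
    refine homogeneous_induction (P := fun Y => SuperRingedSpace.conj U (g.toFun U X Y) =
      g.toFun U X.conj Y.conj) ?_ ?_ Y
    · intro b Y hY
      rw [hX.conj_eq, hY.conj_eq, g.real_smul_left, g.real_smul_right, smul_smul, ← sgn_add]
      exact g.even U X Y a b hX hY
    · intro Y Y' h h'
      rw [g.add_right, map_add, h, h', VectorField.conj_add, g.add_right]
  · intro X X' h h'
    rw [g.add_left, map_add, h, h', VectorField.conj_add, g.add_left]

section Frame

variable (χ : M.Chart p q) (hV : V ≤ χ.source)

theorem res_matrix (i j : Fin p ⊕ Fin q) :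
    res hV (g.matrix χ i j) = g.toFun V (χ.frame hV i) (χ.frame hV j) := g.res_toFun _ _ _ _ _

theorem sum_toFun_frame_mul (i j : Fin p ⊕ Fin q) :
    ∑ l, g.toFun V (χ.frame hV i) (χ.frame hV l) * res hV (g.invMatrix χ l j) =
      if i = j then 1 else 0 := by
  have h := congrArg (res hV) (congrFun (congrFun (g.matrix_mul_invMatrix χ) i) j)
  rw [Matrix.mul_apply, map_sum, Matrix.one_apply] at h
  simp only [map_mul, res_matrix] at h
  rw [h]
  split_ifs <;> simp

theorem sum_mul_toFun_frame (i j : Fin p ⊕ Fin q) :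
    ∑ l, res hV (g.invMatrix χ i l) * g.toFun V (χ.frame hV l) (χ.frame hV j) =
      if i = j then 1 else 0 := by
  have h := congrArg (res hV) (congrFun (congrFun (g.invMatrix_mul_matrix χ) i) j)
  rw [Matrix.mul_apply, map_sum, Matrix.one_apply] at h
  simp only [map_mul, res_matrix] at h
  rw [h]
  split_ifs <;> simp

/-- The components of a vector field in terms of its inner products with the frame. -/
theorem apply_coordOn_eq (X : M.VF V) (i : Fin p ⊕ Fin q) :
    X.apply (χ.coordOn hV i) =
      ∑ l, g.toFun V X (χ.frame hV l) * res hV (g.invMatrix χ l i) := by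
  have h : ∀ l, g.toFun V X (χ.frame hV l) =
      ∑ k, X.apply (χ.coordOn hV k) * g.toFun V (χ.frame hV k) (χ.frame hV l) := by
    intro l
    conv_lhs => rw [← χ.sum_apply_smul_frame hV X]
    rw [g.sum_left]
    simp only [g.smul_left]
  simp only [h, Finset.sum_mul, mul_assoc]
  rw [Finset.sum_comm]
  simp only [← Finset.mul_sum, sum_toFun_frame_mul, mul_ite, mul_one, mul_zero,
    Finset.sum_ite_eq', Finset.mem_univ, if_true]

theorem eq_zero_of_toFun_frame {X : M.VF V} (h : ∀ l, g.toFun V X (χ.frame hV l) = 0) : X = 0 := by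
  refine χ.eq_zero_of_apply_coordOn hV fun i => ?_
  rw [g.apply_coordOn_eq χ hV]
  simp [h]

/-- Nondegeneracy: the vector field with given inner products with the frame. -/
theorem exists_toFun_frame_eq (k : Fin p ⊕ Fin q → M.Sec V) :
    ∃ X : M.VF V, ∀ l, g.toFun V X (χ.frame hV l) = k l := by
  -- The coefficients stand on the left, where `g` is linear without signs, so the row `k` is
  -- multiplied by the inverse matrix from the right.
  refine ⟨∑ i, (∑ l, k l * res hV (g.invMatrix χ l i)) • χ.frame hV i, fun m => ?_⟩
  rw [g.sum_left]
  simp only [g.smul_left, Finset.sum_mul, mul_assoc]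
  rw [Finset.sum_comm]
  simp only [← Finset.mul_sum, sum_mul_toFun_frame, mul_ite, mul_one, mul_zero,
    Finset.sum_ite_eq', Finset.mem_univ, if_true]

end Frame

/-- Vector fields over open sets are separated by their inner products. -/
theorem eq_of_toFun_eq {X Y : M.VF U}
    (h : ∀ (V : Opens M.carrier) (hV : V ≤ U) (c : ZMod 2) (Z : M.VF V), Z.IsHomogeneous c →
      g.toFun V (X.restrict hV) Z = g.toFun V (Y.restrict hV) Z) : X = Y := by
  refine VectorField.eq_of_locally_eq fun m hm => ?_
  obtain ⟨χ, hχ⟩ := M.exists_chart m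
  refine ⟨U ⊓ χ.source, inf_le_left, ⟨hm, hχ⟩, sub_eq_zero.1 ?_⟩
  refine g.eq_zero_of_toFun_frame χ inf_le_right fun l => ?_
  rw [g.sub_left, h _ _ _ _ (χ.isHomogeneous_frame inf_le_right l), sub_self]

/-- Vector fields are separated by their inner products with global homogeneous fields. -/
theorem eq_of_toFun_eq_global {X Y : M.VF ⊤}
    (h : ∀ (c : ZMod 2) (Z : M.VF ⊤), Z.IsHomogeneous c → g.toFun ⊤ X Z = g.toFun ⊤ Y Z) :
    X = Y := by
  have h' : ∀ Z, g.toFun ⊤ X Z = g.toFun ⊤ Y Z := homogeneous_induction h fun Z Z' e e' => by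
    rw [g.add_right, g.add_right, e, e']
  refine VectorField.eq_of_locally_eq fun m _ => ?_
  obtain ⟨χ, hχ⟩ := M.exists_chart m
  -- The finitely many frame fields are extended globally from a neighbourhood of `m`. The
  -- extensions need not be homogeneous, which is why the hypothesis was first freed of parity.
  choose Z V hV hm hZ using fun l => exists_global_eq (χ.frame le_rfl l) hχ
  let W : Opens M.carrier := χ.source ⊓ Finset.univ.inf V
  have hW : ∀ l, W ≤ V l := fun l => inf_le_right.trans (Finset.inf_le (Finset.mem_univ l))
  have hWχ : W ≤ χ.source := inf_le_left
  have hmW : m ∈ W := by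
    refine ⟨hχ, ?_⟩
    suffices ∀ s : Finset (Fin p ⊕ Fin q), m ∈ s.inf V from this _
    intro s
    induction s using Finset.cons_induction with
    | empty => exact Opens.mem_top m
    | cons l s _ ih =>
      rw [Finset.inf_cons]
      exact ⟨hm l, ih⟩
  refine ⟨W, le_top, hmW, sub_eq_zero.1 ?_⟩
  refine g.eq_zero_of_toFun_frame χ hWχ fun l => ?_
  have e : χ.frame hWχ l = (Z l).restrict le_top :=
    (congrArg (VectorField.restrict (hW l)) (hZ l)).symm
  rw [g.sub_left, e, ← g.res_toFun, ← g.res_toFun, h', sub_self]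

/-- The right-hand side of the Koszul formula for `2 g(∇_X Y, Z)`, for vector fields of parities
`a`, `b`, `c`. -/
noncomputable def koszul (a b c : ZMod 2) (X Y Z : M.VF U) : M.Sec U :=
  X.apply (g.toFun U Y Z) + sgn (a * b) • Y.apply (g.toFun U X Z)
    - sgn (c * (a + b)) • Z.apply (g.toFun U X Y) + g.toFun U (lie a b X Y) Z
    - sgn (a * b) • g.toFun U Y (lie a c X Z) - g.toFun U X (lie b c Y Z)

variable {g}

theorem koszul_add_left (a b c : ZMod 2) (X X' Y Z : M.VF U) :
    g.koszul a b c (X + X') Y Z = g.koszul a b c X Y Z + g.koszul a b c X' Y Z := by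
  simp only [koszul, add_apply, apply_add, lie_add_left, g.add_left, g.add_right, smul_add]
  abel

theorem koszul_add_mid (a b c : ZMod 2) (X Y Y' Z : M.VF U) :
    g.koszul a b c X (Y + Y') Z = g.koszul a b c X Y Z + g.koszul a b c X Y' Z := by
  simp only [koszul, add_apply, apply_add, lie_add_left, lie_add_right, g.add_left, g.add_right,
    smul_add]
  abel

theorem koszul_add_right (a b c : ZMod 2) (X Y Z Z' : M.VF U) :
    g.koszul a b c X Y (Z + Z') = g.koszul a b c X Y Z + g.koszul a b c X Y Z' := by
  simp only [koszul, add_apply, apply_add, lie_add_right, g.add_right, smul_add]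
  abel

theorem res_koszul (h : V ≤ U) (a b c : ZMod 2) (X Y Z : M.VF U) :
    res h (g.koszul a b c X Y Z) =
      g.koszul a b c (X.restrict h) (Y.restrict h) (Z.restrict h) := by
  simp only [koszul, map_add, map_sub, map_smul, res_apply, g.res_toFun, restrict_lie]

section Homogeneous

variable {X Y Z : M.VF U} {f : M.Sec U} {a b c d : ZMod 2}

theorem isHomogeneous_koszul (hX : X.IsHomogeneous a) (hY : Y.IsHomogeneous b)
    (hZ : Z.IsHomogeneous c) :
    SuperRingedSpace.IsHomogeneous (g.koszul a b c X Y Z) (a + b + c) := by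
  have h1 := hX.apply (g.even U Y Z b c hY hZ)
  have h2 := (hY.apply (g.even U X Z a c hX hZ)).smul (sgn (a * b))
  have h3 := (hZ.apply (g.even U X Y a b hX hY)).smul (-sgn (c * (a + b)))
  have h4 := g.even U _ Z _ c (isHomogeneous_lie hX hY) hZ
  have h5 := (g.even U Y _ b _ hY (isHomogeneous_lie hX hZ)).smul (-sgn (a * b))
  have h6 := (g.even U X _ a _ hX (isHomogeneous_lie hY hZ)).smul (-1)
  rw [show a + (b + c) = a + b + c by ring] at h1 h6
  rw [show b + (a + c) = a + b + c by ring] at h2 h5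
  rw [show c + (a + b) = a + b + c by ring] at h3
  have := ((((h1.add h2).add h3).add h4).add h5).add h6
  simpa only [koszul, neg_smul, one_smul, ← sub_eq_add_neg] using this

/-- The terms with `X(f)` and `Y(f)` from differentiating `g(Y, f Z)` and `g(X, f Z)` cancel those
from `[X, f Z]` and `[Y, f Z]`. The sign is the one for `g(N, f Z)` with `N` of parity `a + b`. -/
theorem koszul_smul_right (hX : X.IsHomogeneous a) (hY : Y.IsHomogeneous b)
    (hZ : Z.IsHomogeneous c) (hf : SuperRingedSpace.IsHomogeneous f d) :
    g.koszul a b (d + c) X Y (f • Z) = sgn ((a + b) * d) • (f * g.koszul a b c X Y Z) := by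
  simp only [koszul, lie_smul_right hX hZ hf, lie_smul_right hY hZ hf, g.add_right,
    g.real_smul_right, VectorField.smul_apply,
    g.smul_right U f X _ a d hX hf, g.smul_right U f Y _ b d hY hf,
    g.smul_right U f _ Z _ d (isHomogeneous_lie hX hY) hf,
    g.smul_right U _ Y Z b _ hY (hX.apply hf), g.smul_right U _ X Z a _ hX (hY.apply hf),
    apply_real_smul, hX.apply_mul hf, hY.apply_mul hf, mul_add, mul_sub, smul_add, smul_sub,
    mul_smul_comm, smul_smul]
  rcases zmod_two a with rfl | rfl <;> rcases zmod_two b with rfl | rfl <;>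
    rcases zmod_two c with rfl | rfl <;> rcases zmod_two d with rfl | rfl <;>
    simp [show (1 : ZMod 2) + 1 = 0 from rfl] <;> abel

/-- The `Y(f)` terms cancel against `[f X, Y]`, and the `Z(f)` terms against `[f X, Z]` after using
the symmetry of `g`. -/
theorem koszul_smul_left (hX : X.IsHomogeneous a) (hY : Y.IsHomogeneous b)
    (hZ : Z.IsHomogeneous c) (hf : SuperRingedSpace.IsHomogeneous f d) :
    g.koszul (d + a) b c (f • X) Y Z = f * g.koszul a b c X Y Z := by
  simp only [koszul, lie_smul_left hX hY hf, lie_smul_left hX hZ hf, g.sub_left, g.sub_right,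
    g.real_smul_left, g.real_smul_right, VectorField.smul_apply, g.smul_left,
    g.smul_right U f Y _ b d hY hf, g.smul_right U _ Y X b _ hY (hZ.apply hf),
    g.symm U X Y a b hX hY, hY.apply_mul hf, hZ.apply_mul hf,
    mul_add, mul_sub, smul_add, smul_sub, mul_smul_comm, smul_smul]
  rcases zmod_two a with rfl | rfl <;> rcases zmod_two b with rfl | rfl <;>
    rcases zmod_two c with rfl | rfl <;> rcases zmod_two d with rfl | rfl <;>
    simp [show (1 : ZMod 2) + 1 = 0 from rfl] <;> abel

/-- The `Z(f)` terms cancel, but those with `X(f)` from `X(g(f Y, Z))` and from `g([X, f Y], Z)` add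
up. The resulting factor `2` matches that of the Koszul formula and yields the Leibniz rule. -/
theorem koszul_smul_mid (hX : X.IsHomogeneous a) (hY : Y.IsHomogeneous b)
    (hZ : Z.IsHomogeneous c) (hf : SuperRingedSpace.IsHomogeneous f d) :
    g.koszul a (d + b) c X (f • Y) Z =
      (2 : ℝ) • (X.apply f * g.toFun U Y Z) + sgn (a * d) • (f * g.koszul a b c X Y Z) := by
  simp only [koszul, lie_smul_right hX hY hf, lie_smul_left hY hZ hf, g.add_left, g.sub_right,
    g.real_smul_left, g.real_smul_right, VectorField.smul_apply, g.smul_left,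
    g.smul_right U f X _ a d hX hf, g.smul_right U _ X Y a _ hX (hZ.apply hf),
    apply_real_smul, hX.apply_mul hf, hZ.apply_mul hf,
    mul_add, mul_sub, smul_add, smul_sub, mul_smul_comm, smul_smul, two_smul]
  rcases zmod_two a with rfl | rfl <;> rcases zmod_two b with rfl | rfl <;>
    rcases zmod_two c with rfl | rfl <;> rcases zmod_two d with rfl | rfl <;>
    simp [show (1 : ZMod 2) + 1 = 0 from rfl] <;> abel

/-- Becomes vanishing torsion: every term is graded symmetric in `X`, `Y`, alone or with its
partner, except `g([X, Y], Z)`, which is antisymmetric. -/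
theorem koszul_sub_swap (hX : X.IsHomogeneous a) (hY : Y.IsHomogeneous b) :
    g.koszul a b c X Y Z - sgn (a * b) • g.koszul b a c Y X Z =
      (2 : ℝ) • g.toFun U (lie a b X Y) Z := by
  have h : g.toFun U (lie b a Y X) Z = -(sgn (a * b) • g.toFun U (lie a b X Y) Z) := by
    rw [lie_swap hX hY, ← neg_smul, g.real_smul_left, neg_smul]
  simp only [koszul, h, g.symm U X Y a b hX hY, apply_real_smul, smul_add, smul_sub, smul_neg,
    smul_smul, two_smul]
  rcases zmod_two a with rfl | rfl <;> rcases zmod_two b with rfl | rfl <;>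
    simp <;> abel

/-- Becomes compatibility: all terms except `X(g(Y, Z))` cancel under graded symmetrization in `Y`,
`Z`. -/
theorem koszul_add_swap (hX : X.IsHomogeneous a) (hY : Y.IsHomogeneous b)
    (hZ : Z.IsHomogeneous c) :
    g.koszul a b c X Y Z + sgn (b * c) • g.koszul a c b X Z Y =
      (2 : ℝ) • X.apply (g.toFun U Y Z) := by
  have h : g.toFun U X (lie c b Z Y) = -(sgn (b * c) • g.toFun U X (lie b c Y Z)) := by
    rw [lie_swap hY hZ, g.neg_right, g.real_smul_right]
  simp only [koszul, h, g.symm U Y Z b c hY hZ, apply_real_smul,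
    g.symm U Y _ b _ hY (isHomogeneous_lie hX hZ), g.symm U _ Z _ c (isHomogeneous_lie hX hY) hZ,
    smul_add, smul_sub, smul_neg, smul_smul, two_smul]
  rcases zmod_two a with rfl | rfl <;> rcases zmod_two b with rfl | rfl <;>
    rcases zmod_two c with rfl | rfl <;>
    simp [show (1 : ZMod 2) + 1 = 0 from rfl] <;> abel

end Homogeneous

end Supermanifold.Metric

/-! ### The Levi-Civita connection -/

namespace Supermanifold

open SuperRingedSpace VectorField

variable {p q : ℕ} {M : Supermanifold.{u} p q} {g : M.Metric} {U V : Opens M.carrier}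

variable (g) in
/-- `N` satisfies the Koszul formula `2 g(N, Z) = K(X, Y, Z)` for all homogeneous vector fields `Z`
over open subsets of `U`, where `a`, `b` are the parities of `X`, `Y`. -/
def IsKoszul (a b : ZMod 2) (X Y N : M.VF U) : Prop :=
  ∀ (V : Opens M.carrier) (hV : V ≤ U) (c : ZMod 2) (Z : M.VF V), Z.IsHomogeneous c →
    (2 : ℝ) • g.toFun V (N.restrict hV) Z = g.koszul a b c (X.restrict hV) (Y.restrict hV) Z

namespace IsKoszul

variable {a b d : ZMod 2} {X X' Y Y' N N' : M.VF U} {f : M.Sec U}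

theorem restrict (h : IsKoszul g a b X Y N) (hV : V ≤ U) :
    IsKoszul g a b (X.restrict hV) (Y.restrict hV) (N.restrict hV) :=
  fun V' hV' c Z hZ => h V' (hV'.trans hV) c Z hZ

/-- The test fields over small open sets include the chart frames, so nondegeneracy applies
directly, without extending fields. -/
theorem unique (h : IsKoszul g a b X Y N) (h' : IsKoszul g a b X Y N') : N = N' :=
  g.eq_of_toFun_eq fun V hV c Z hZ => smul_right_injective _ (two_ne_zero (α := ℝ))
    ((h V hV c Z hZ).trans (h' V hV c Z hZ).symm)

theorem add_left (h : IsKoszul g a b X Y N) (h' : IsKoszul g a b X' Y N') :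
    IsKoszul g a b (X + X') Y (N + N') := fun V hV c Z hZ => by
  rw [restrict_add, restrict_add, g.add_left, smul_add, h V hV c Z hZ, h' V hV c Z hZ,
    Metric.koszul_add_left]

theorem add_right (h : IsKoszul g a b X Y N) (h' : IsKoszul g a b X Y' N') :
    IsKoszul g a b X (Y + Y') (N + N') := fun V hV c Z hZ => by
  rw [restrict_add, restrict_add, g.add_left, smul_add, h V hV c Z hZ, h' V hV c Z hZ,
    Metric.koszul_add_mid]

/-- `N + N` solves the formula for `0 + 0 = 0` too, so it equals `N`. This discards the parity
components that vanish in `isKoszul_nabla`. -/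
theorem eq_zero_of_left (h : IsKoszul g a b 0 Y N) : N = 0 := by
  have := h.add_left h
  rw [add_zero] at this
  simpa using this.unique h

theorem eq_zero_of_right (h : IsKoszul g a b X 0 N) : N = 0 := by
  have := h.add_right h
  rw [add_zero] at this
  simpa using this.unique h

theorem smul_left (h : IsKoszul g a b X Y N) (hX : X.IsHomogeneous a) (hY : Y.IsHomogeneous b)
    (hf : SuperRingedSpace.IsHomogeneous f d) : IsKoszul g (d + a) b (f • X) Y (f • N) :=
  fun V hV c Z hZ => by
    rw [restrict_smul, restrict_smul, g.smul_left, ← mul_smul_comm, h V hV c Z hZ,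
      Metric.koszul_smul_left (hX.restrict hV) (hY.restrict hV) hZ (hf.res hV)]

theorem smul_right (h : IsKoszul g a b X Y N) (hX : X.IsHomogeneous a) (hY : Y.IsHomogeneous b)
    (hf : SuperRingedSpace.IsHomogeneous f d) :
    IsKoszul g a (d + b) X (f • Y) (X.apply f • Y + (sgn (a * d) • f) • N) :=
  fun V hV c Z hZ => by
    rw [restrict_add, restrict_smul, restrict_smul, restrict_smul, g.add_left, g.smul_left,
      g.smul_left, Metric.koszul_smul_mid (hX.restrict hV) (hY.restrict hV) hZ (hf.res hV),
      ← h V hV c Z hZ, res_apply, map_smul, smul_add, smul_mul_assoc, mul_smul_comm,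
      smul_comm (2 : ℝ) (sgn _)]

theorem isHomogeneous (h : IsKoszul g a b X Y N) (hX : X.IsHomogeneous a)
    (hY : Y.IsHomogeneous b) : N.IsHomogeneous (a + b) := by
  refine isHomogeneous_iff.2 (g.eq_of_toFun_eq fun V hV c Z hZ => ?_)
  have h1 : SuperRingedSpace.IsHomogeneous (g.toFun V (N.restrict hV) Z) (a + b + c) := by
    have := (Metric.isHomogeneous_koszul (g := g) (hX.restrict hV) (hY.restrict hV) hZ).smul
      (1 / 2)
    rw [← h V hV c Z hZ, smul_smul] at this
    simpa using this
  have h2 := g.conj_toFun (N.restrict hV) Z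
  rw [hZ.conj_eq, g.real_smul_right, ← restrict_conj, show SuperRingedSpace.conj V _ = _ from h1,
    sgn_add, mul_comm, mul_smul] at h2
  have h3 := congrArg (sgn c • ·) h2
  simp only [smul_sgn_smul] at h3
  rw [restrict_real_smul, g.real_smul_left, h3]

end IsKoszul

variable {a b : ZMod 2} {X Y : M.VF U}

/-- Nondegeneracy solves the formula for the frame fields; graded linearity of both sides in `Z`
extends it to every homogeneous `Z`. -/
theorem exists_isKoszul_of_le_source (χ : M.Chart p q) (hU : U ≤ χ.source)
    (hX : X.IsHomogeneous a) (hY : Y.IsHomogeneous b) : ∃ N, IsKoszul g a b X Y N := by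
  obtain ⟨N, hN⟩ := g.exists_toFun_frame_eq χ hU fun l =>
    (1 / 2 : ℝ) • g.koszul a b (parity l) X Y (χ.frame hU l)
  -- The parity of `N` is needed first: it fixes the sign with which coefficients of `Z` leave `g(N,
  -- ·)`.
  have hNh : N.IsHomogeneous (a + b) := by
    refine isHomogeneous_iff.2 (sub_eq_zero.1 (g.eq_zero_of_toFun_frame χ hU fun l => ?_))
    have hl := χ.isHomogeneous_frame hU l
    have h1 : SuperRingedSpace.IsHomogeneous (g.toFun U N (χ.frame hU l)) (a + b + parity l) := by
      rw [hN]
      exact (Metric.isHomogeneous_koszul hX hY hl).smul _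
    have h2 := g.conj_toFun N (χ.frame hU l)
    rw [hl.conj_eq, g.real_smul_right, show SuperRingedSpace.conj U _ = _ from h1,
      sgn_add, mul_comm, mul_smul] at h2
    have h3 := congrArg (sgn (parity l) • ·) h2
    simp only [smul_sgn_smul] at h3
    rw [g.sub_left, g.real_smul_left, h3, sub_self]
  refine ⟨N, fun V hV c Z hZ => ?_⟩
  have hs := hV.trans hU
  have hsum : ∀ W : Fin p ⊕ Fin q → M.VF V, g.koszul a b c (X.restrict hV) (Y.restrict hV)
      (∑ i, W i) = ∑ i, g.koszul a b c (X.restrict hV) (Y.restrict hV) (W i) := fun W =>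
    map_sum (AddMonoidHom.mk' (g.koszul a b c (X.restrict hV) (Y.restrict hV))
      (Metric.koszul_add_right a b c _ _)) W _
  rw [← χ.sum_apply_smul_frame hs Z, hsum, g.sum_right, Finset.smul_sum]
  refine Finset.sum_congr rfl fun i _ => ?_
  have hZi : SuperRingedSpace.IsHomogeneous (Z.apply (χ.coordOn hs i)) (c + parity i) :=
    hZ.apply (χ.isHomogeneous_coordOn hs i)
  have hi := χ.isHomogeneous_frame hs i
  -- The component `Z(x^i)` has parity `c + ε_i`, so `c` is split as its parity plus that of the
  -- frame field.
  have hc : c = c + parity i + parity i := by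
    rw [add_assoc, CharTwo.add_self_eq_zero, add_zero]
  have hN' := congrArg (res hV) (hN i)
  rw [g.res_toFun, χ.restrict_frame, map_smul, Metric.res_koszul, χ.restrict_frame] at hN'
  rw [g.smul_right V _ _ _ (a + b) _ (hNh.restrict hV) hZi, hN']
  conv_rhs => rw [hc]
  rw [Metric.koszul_smul_right (hX.restrict hV) (hY.restrict hV) hi hZi, mul_smul_comm, smul_smul,
    smul_smul]
  congr 1
  ring

/-- Chart solutions agree on overlaps by uniqueness and therefore glue. As both sides of the formula
commute with restriction, it may be checked chart by chart. -/
theorem exists_isKoszul (hX : X.IsHomogeneous a) (hY : Y.IsHomogeneous b) :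
    ∃ N, IsKoszul g a b X Y N := by
  choose χ hχ using M.exists_chart
  choose N hN using fun m => exists_isKoszul_of_le_source (g := g) (χ m)
    (inf_le_right : U ⊓ (χ m).source ≤ _) (hX.restrict inf_le_left) (hY.restrict inf_le_left)
  have hcover : U ≤ ⨆ m, U ⊓ (χ m).source := fun m hm => Opens.mem_iSup.2 ⟨m, hm, hχ m⟩
  obtain ⟨N', hN'⟩ := exists_restrict_eq (fun m => U ⊓ (χ m).source) (fun m => inf_le_left) hcover N
    fun i j => ((hN i).restrict inf_le_left).unique ((hN j).restrict inf_le_right)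
  refine ⟨N', fun V hV c Z hZ => ?_⟩
  refine eq_of_res_eq (fun m => V ⊓ (χ m).source) (fun m => inf_le_left)
    (fun m hm => Opens.mem_iSup.2 ⟨m, hm, hχ m⟩) fun m => ?_
  have hm : V ⊓ (χ m).source ≤ U ⊓ (χ m).source := inf_le_inf_right _ hV
  have h := hN m _ hm c _ (hZ.restrict inf_le_left)
  rw [← hN' m] at h
  rw [map_smul, g.res_toFun, Metric.res_koszul]
  exact h

variable (g)

/-- The solution of the Koszul formula for the components of parities `a` and `b` of `X` and `Y`. -/
noncomputable def nablaPart (a b : ZMod 2) (X Y : M.VF U) : M.VF U :=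
  (exists_isKoszul (g := g) (isHomogeneous_part a X) (isHomogeneous_part b Y)).choose

theorem isKoszul_nablaPart (a b : ZMod 2) (X Y : M.VF U) :
    IsKoszul g a b (part a X) (part b Y) (nablaPart g a b X Y) :=
  (exists_isKoszul (g := g) (isHomogeneous_part a X) (isHomogeneous_part b Y)).choose_spec

/-- The covariant derivative `∇_X Y` of the Levi-Civita connection. -/
noncomputable def nabla (X Y : M.VF U) : M.VF U := ∑ a, ∑ b, nablaPart g a b X Y

theorem nabla_add_left (X X' Y : M.VF U) : nabla g (X + X') Y = nabla g X Y + nabla g X' Y := by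
  simp only [nabla, ← Finset.sum_add_distrib]
  refine Finset.sum_congr rfl fun a _ => Finset.sum_congr rfl fun b _ => ?_
  have h := isKoszul_nablaPart g a b (X + X') Y
  rw [part_add] at h
  exact h.unique ((isKoszul_nablaPart g a b X Y).add_left (isKoszul_nablaPart g a b X' Y))

theorem nabla_add_right (X Y Y' : M.VF U) : nabla g X (Y + Y') = nabla g X Y + nabla g X Y' := by
  simp only [nabla, ← Finset.sum_add_distrib]
  refine Finset.sum_congr rfl fun a _ => Finset.sum_congr rfl fun b _ => ?_
  have h := isKoszul_nablaPart g a b X (Y + Y')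
  rw [part_add] at h
  exact h.unique ((isKoszul_nablaPart g a b X Y).add_right (isKoszul_nablaPart g a b X Y'))

theorem isKoszul_nabla (hX : X.IsHomogeneous a) (hY : Y.IsHomogeneous b) :
    IsKoszul g a b X Y (nabla g X Y) := by
  have h : nabla g X Y = nablaPart g a b X Y := by
    rw [nabla, Finset.sum_eq_single a, Finset.sum_eq_single b]
    · intro b' _ hb
      have h := isKoszul_nablaPart g a b' X Y
      rw [hY.part_eq, if_neg hb] at h
      exact h.eq_zero_of_right
    · simp
    · intro a' _ ha
      refine Finset.sum_eq_zero fun b' _ => ?_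
      have h := isKoszul_nablaPart g a' b' X Y
      rw [hX.part_eq, if_neg ha] at h
      exact h.eq_zero_of_left
    · simp
  have h' := isKoszul_nablaPart g a b X Y
  rwa [hX.part_self, hY.part_self, ← h] at h'

/-- For homogeneous fields both sides solve the same Koszul formula on `V`, where solutions are
unique. -/
theorem restrict_nabla (hV : V ≤ U) (X Y : M.VF U) :
    (nabla g X Y).restrict hV = nabla g (X.restrict hV) (Y.restrict hV) := by
  refine homogeneous_induction (P := fun X => (nabla g X Y).restrict hV =
    nabla g (X.restrict hV) (Y.restrict hV)) ?_ ?_ X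
  · intro a X hX
    refine homogeneous_induction (P := fun Y => (nabla g X Y).restrict hV =
      nabla g (X.restrict hV) (Y.restrict hV)) ?_ ?_ Y
    · intro b Y hY
      exact ((isKoszul_nabla g hX hY).restrict hV).unique
        (isKoszul_nabla g (hX.restrict hV) (hY.restrict hV))
    · intro Y Y' h h'
      rw [nabla_add_right, restrict_add, h, h', restrict_add, nabla_add_right]
  · intro X X' h h'
    rw [nabla_add_left, restrict_add, h, h', restrict_add, nabla_add_left]

variable (U) in
/-- The Levi-Civita connection on `U`. -/
noncomputable def leviCivita : M.Connection U where
  toFun := nabla g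
  add_left := nabla_add_left g
  add_right := nabla_add_right g
  smul_left f X Y := by
    refine sec_induction (P := fun f => nabla g (f • X) Y = f • nabla g X Y) ?_ ?_ f
    · intro d f hf
      refine homogeneous_induction (P := fun X => nabla g (f • X) Y = f • nabla g X Y) ?_ ?_ X
      · intro a X hX
        refine homogeneous_induction (P := fun Y => nabla g (f • X) Y = f • nabla g X Y) ?_ ?_ Y
        · intro b Y hY
          exact (isKoszul_nabla g (hX.smul hf) hY).unique
            ((isKoszul_nabla g hX hY).smul_left hX hY hf)
        · intro Y Y' h h'
          rw [nabla_add_right, nabla_add_right, h, h', smul_add]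
      · intro X X' h h'
        rw [smul_add, nabla_add_left, nabla_add_left, h, h', smul_add]
    · intro f f' h h'
      rw [add_smul, nabla_add_left, h, h', add_smul]
  leibniz f X Y a d hX hf := by
    refine homogeneous_induction (P := fun Y => nabla g X (f • Y) =
      X.apply f • Y + (sgn (a * d) • f) • nabla g X Y) ?_ ?_ Y
    · intro b Y hY
      exact (isKoszul_nabla g hX (hY.smul hf)).unique
        ((isKoszul_nabla g hX hY).smul_right hX hY hf)
    · intro Y Y' h h'
      rw [smul_add, nabla_add_right, nabla_add_right, h, h', smul_add, smul_add]
      abel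
  even X Y a b hX hY := (isKoszul_nabla g hX hY).isHomogeneous hX hY

theorem nabla_sub_nabla (hX : X.IsHomogeneous a) (hY : Y.IsHomogeneous b) :
    nabla g X Y - sgn (a * b) • nabla g Y X = lie a b X Y := by
  refine g.eq_of_toFun_eq fun V hV c Z hZ => smul_right_injective _ (two_ne_zero (α := ℝ)) ?_
  change (2 : ℝ) • _ = (2 : ℝ) • _
  rw [restrict_sub, restrict_real_smul, g.sub_left, g.real_smul_left, smul_sub,
    smul_comm (2 : ℝ) (sgn _), isKoszul_nabla g hX hY V hV c Z hZ,
    isKoszul_nabla g hY hX V hV c Z hZ, restrict_lie,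
    Metric.koszul_sub_swap (hX.restrict hV) (hY.restrict hV)]

theorem isTorsionFree_leviCivita : (leviCivita g U).IsTorsionFree := by
  intro X Y a b hX hY V hV
  ext f
  have h := congrArg (fun Z : M.VF U => Z.toFun V hV f) (nabla_sub_nabla g hX hY)
  simp only [sub_toFun, real_smul_toFun, lie_toFun hX hY] at h
  exact sub_eq_zero.2 h

theorem isCompatible_leviCivita : (leviCivita g U).IsCompatible g := by
  intro X Y Z a b c hX hY hZ
  refine smul_right_injective _ (two_ne_zero (α := ℝ)) ?_
  change (2 : ℝ) • _ = (2 : ℝ) • (g.toFun U (nabla g X Y) Z +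
    sgn (a * b) • g.toFun U Y (nabla g X Z))
  have h1 := isKoszul_nabla g hX hY U le_rfl c Z hZ
  have h2 := isKoszul_nabla g hX hZ U le_rfl b Y hY
  simp only [restrict_self] at h1 h2
  -- Symmetry brings `∇_X Z` into the first slot. The total sign exponent `a b + (a + c) b` is `b c`
  -- modulo `2`, the one in `koszul_add_swap`.
  rw [g.symm U (nabla g X Z) Y (a + c) b ((isKoszul_nabla g hX hZ).isHomogeneous hX hZ) hY,
    smul_smul, smul_add, smul_comm (2 : ℝ) (_ * _), h1, h2, ← sgn_add,
    show a * b + (a + c) * b = b * c + (a * b + a * b) by ring, CharTwo.add_self_eq_zero, add_zero,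
    Metric.koszul_add_swap hX hY hZ]

variable {g}

/-- The Koszul formula for torsion-free and compatible connections. -/
theorem Connection.IsCompatible.two_smul_toFun {D : M.Connection U} (hD : D.IsCompatible g)
    (hT : D.IsTorsionFree) {Z : M.VF U} {c : ZMod 2} (hX : X.IsHomogeneous a)
    (hY : Y.IsHomogeneous b) (hZ : Z.IsHomogeneous c) :
    (2 : ℝ) • g.toFun U (D.toFun X Y) Z = g.koszul a b c X Y Z := by
  have hlie : ∀ {X Y : M.VF U} {a b : ZMod 2}, X.IsHomogeneous a → Y.IsHomogeneous b →
      lie a b X Y = D.toFun X Y - sgn (a * b) • D.toFun Y X := by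
    intro X Y a b hX hY
    ext V hV f
    rw [lie_toFun hX hY, sub_toFun, real_smul_toFun]
    exact (sub_eq_zero.1 (LinearMap.congr_fun (hT X Y a b hX hY V hV) f)).symm
  -- Once derivatives and brackets are expressed through `D`, everything cancels except two copies
  -- of `g(D_X Y, Z)`.
  simp only [Metric.koszul, hlie hX hY, hlie hX hZ, hlie hY hZ, hD X Y Z a b c hX hY hZ,
    hD Y X Z b a c hY hX hZ, hD Z X Y c a b hZ hX hY, g.sub_left, g.sub_right, g.real_smul_left,
    g.real_smul_right, g.symm U Y _ b _ hY (D.even Z X c a hZ hX), smul_add, smul_sub, smul_smul,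
    two_smul]
  rcases zmod_two a with rfl | rfl <;> rcases zmod_two b with rfl | rfl <;>
    rcases zmod_two c with rfl | rfl <;>
    simp [show (1 : ZMod 2) + 1 = 0 from rfl] <;> abel

/-- Both connections satisfy the Koszul formula. `D` acts on global fields only, so global test
fields `Z` have to separate. -/
theorem eq_leviCivita {D : M.Connection ⊤} (hT : D.IsTorsionFree) (hD : D.IsCompatible g) :
    D = leviCivita g ⊤ := by
  ext1 X Y
  change D.toFun X Y = nabla g X Y
  refine homogeneous_induction (P := fun X => D.toFun X Y = nabla g X Y) ?_ ?_ X
  · intro a X hX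
    refine homogeneous_induction (P := fun Y => D.toFun X Y = nabla g X Y) ?_ ?_ Y
    · intro b Y hY
      refine g.eq_of_toFun_eq_global fun c Z hZ => smul_right_injective _ (two_ne_zero (α := ℝ)) ?_
      exact (hD.two_smul_toFun hT hX hY hZ).trans
        ((isCompatible_leviCivita g).two_smul_toFun (isTorsionFree_leviCivita g) hX hY hZ).symm
    · intro Y Y' h h'
      rw [D.add_right, nabla_add_right, h, h']
  · intro X X' h h'
    rw [D.add_left, nabla_add_left, h, h']

theorem christoffel_leviCivita (χ : M.Chart p q) (i j k : Fin p ⊕ Fin q) :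
    (leviCivita g χ.source).christoffel i j k = (1 / 2 : ℝ) • ∑ l : Fin p ⊕ Fin q,
      ((χ.coordField j).apply (g.matrix χ k l)
        + sgn (parity j * parity k) • (χ.coordField k).apply (g.matrix χ j l)
        - sgn (parity l * (parity j + parity k)) • (χ.coordField l).apply (g.matrix χ j k))
      * g.invMatrix χ l i := by
  have hi : χ.coord i = χ.coordOn le_rfl i := (res_self _).symm
  change (nabla g (χ.frame le_rfl j) (χ.frame le_rfl k)).apply (χ.coord i) = _
  rw [hi, g.apply_coordOn_eq χ le_rfl, Finset.smul_sum]
  refine Finset.sum_congr rfl fun l _ => ?_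
  have h := isKoszul_nabla g (χ.isHomogeneous_frame le_rfl j) (χ.isHomogeneous_frame le_rfl k) _
    le_rfl _ _ (χ.isHomogeneous_frame le_rfl l)
  -- The coordinate fields have zero brackets, so only the three derivative terms of the Koszul
  -- expression remain.
  simp only [restrict_self, Metric.koszul, χ.lie_frame, g.zero_left,
    show ∀ X, g.toFun χ.source X 0 = 0 from fun X => map_zero (g.rightHom X), smul_zero, add_zero,
    sub_zero] at h
  have h' := congrArg ((1 / 2 : ℝ) • ·) h
  simp only [smul_smul, one_div, inv_mul_cancel₀ (two_ne_zero (α := ℝ)), one_smul] at h'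
  rw [res_self, h', one_div, smul_mul_assoc]
  rfl

end Supermanifold

theorem mainTheorem4 {p q : ℕ} (M : Supermanifold.{u} p q) (g : M.Metric) :
    ∃ D : M.Connection ⊤, (D.IsTorsionFree ∧ D.IsCompatible g) ∧
      (∀ D' : M.Connection ⊤, D'.IsTorsionFree → D'.IsCompatible g → D' = D) ∧
      ∀ χ : M.Chart p q, ∃ D' : M.Connection χ.source,
        D.IsRestriction le_top D' ∧
        (∀ D'' : M.Connection χ.source, D.IsRestriction le_top D'' → D'' = D') ∧
        ∀ i j k : Fin p ⊕ Fin q,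
          D'.christoffel i j k = (1 / 2 : ℝ) • ∑ l : Fin p ⊕ Fin q,
            ((χ.coordField j).apply (g.matrix χ k l)
              + sgn (parity j * parity k) • (χ.coordField k).apply (g.matrix χ j l)
              - sgn (parity l * (parity j + parity k)) • (χ.coordField l).apply (g.matrix χ j k))
            * g.invMatrix χ l i := by
  have hr : ∀ χ : M.Chart p q, (Supermanifold.leviCivita g ⊤).IsRestriction le_top
      (Supermanifold.leviCivita g χ.source) := fun χ X Y =>
    (Supermanifold.restrict_nabla g le_top X Y).symm
  exact ⟨Supermanifold.leviCivita g ⊤,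
    ⟨Supermanifold.isTorsionFree_leviCivita g, Supermanifold.isCompatible_leviCivita g⟩,
    fun _ => Supermanifold.eq_leviCivita, fun χ => ⟨Supermanifold.leviCivita g χ.source, hr χ,
      fun _ h => h.unique (hr χ), Supermanifold.christoffel_leviCivita χ⟩⟩
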